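/- Let $n\in\{2,3\}$. For $1\le p\le\infty$ and $\sigma\in\mathbb R$ let $L^p_\sigma(\mathbb R^n)$ be the set of measurable $f$ with $(1+|x|^2)^{\sigma/2}f\in L^p(\mathbb R^n)$, and let $H^1_\sigma(\mathbb R^n)$ be the set of $f\in L^2_\sigma(\mathbb R^n)$ whose weak gradient lies in $L^2_\sigma(\mathbb R^n)$. Let $\vec W:\mathbb R^n\to\mathbb R^n$ and $V:\mathbb R^n\to\mathbb R$ satisfy $$\vec W\in L^\infty_{\delta}(\mathbb R^n),\qquad \nabla\vec W\in L^{p_1}_{\delta_1}(\mathbb R^n),\qquad V\in L^{p_2}_{\delta_2}(\mathbb R^n),$$ where $\nabla \vec W$ is the weak gradient, $3\le p_j\le\infty$ if $n=3$ and $2<p_j\le\infty$ if $n=2$ ($j=1,2$), and each weight exceeds $\frac{n+1}{2}-\frac np$ for the exponent $p$ of its own space: $\delta>\frac{n+1}{2}$ and $\delta_j>\frac{n+1}{2}-\frac{n}{p_j}$. For $k\in\mathbb R\setminus\{0\}$ let $$G_k^+(r)=\frac i4\Big(\frac{|k|}{2\pi r}\Big)^{\frac{n-2}{2}}H^{(1)}_{\frac{n-2}{2}}(|k|r),\qquad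 r>0,$$ where $H^{(1)}_\nu$ is the Hankel function of the first kind, be the kernel of $(-\Delta-k^2-i0)^{-1}$, and define $$L_kf(x)=\int_{\mathbb R^n}G_k^+(|x-y|)\Big(i\,\nabla\cdot(\vec Wf)(y)+i\,\vec W(y)\cdot\nabla f(y)-\big(|\vec W(y)|^2+V(y)\big)f(y)\Big)\,dy,$$ with weak derivatives. Then there is $\delta_0>\frac12$ such that for every real $k\neq0$: (a) for every $\theta\in\mathbb S^{n-1}$ and $u_0(x)=e^{ik(x,\theta)}$, the function $\tilde u_0=L_ku_0$ is well defined and belongs to $H^1_{-\delta_0}(\mathbb R^n)$; (b) for every $f\in H^1_{-\delta_0}(\mathbb R^n)$, the function $L_kf$ is well defined and belongs to $H^1_{-\delta_0}(\mathbb R^n)$. Here "well defined" means that the weak derivatives $\partial_j f$ and $\partial_j(W_jf)$ (respectively those for $u_0$) exist as locally integrable functions and that the integral converges absolutely for almost every $x$. -/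

import Mathlib

open MeasureTheory
open scoped ContDiff

noncomputable section

namespace MagneticScattering

/-- Euclidean space `ℝⁿ`. -/
abbrev E (n : ℕ) : Type := EuclideanSpace ℝ (Fin n)

/-- The weighted Lebesgue space `L^p_σ(ℝⁿ)`: `(1 + |x|²)^{σ/2} f` belongs to `L^p(ℝⁿ)`. -/
def MemWLp {n : ℕ} {F : Type*} [NormedAddCommGroup F] [NormedSpace ℝ F]
    (p : ENNReal) (σ : ℝ) (f : E n → F) : Prop :=
  MemLp (fun x => ((1 + ‖x‖ ^ 2) ^ (σ / 2) : ℝ) • f x) p volume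

/-- `g` is the weak (distributional) partial derivative `∂f/∂xᵢ`. -/
def HasWeakPartial {n : ℕ} {F : Type*} [NormedAddCommGroup F] [NormedSpace ℝ F]
    (i : Fin n) (f g : E n → F) : Prop :=
  LocallyIntegrable f volume ∧ LocallyIntegrable g volume ∧
    ∀ φ : E n → ℝ, ContDiff ℝ ∞ φ → HasCompactSupport φ →
      ∫ x, (fderiv ℝ φ x (EuclideanSpace.single i 1)) • f x = - ∫ x, φ x • g x

open Classical in
/-- The weak partial derivative `∂f/∂xᵢ` as a function (unique up to null sets); it is the zero
function if there is no locally integrable weak derivative. -/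
def weakPartial {n : ℕ} {F : Type*} [NormedAddCommGroup F] [NormedSpace ℝ F]
    (i : Fin n) (f : E n → F) : E n → F :=
  if h : ∃ g, HasWeakPartial i f g then h.choose else 0

/-- The weak gradient of `f` exists and belongs to `L^p_σ(ℝⁿ)` (componentwise). -/
def WeakGradMemWLp {n : ℕ} {F : Type*} [NormedAddCommGroup F] [NormedSpace ℝ F]
    (p : ENNReal) (σ : ℝ) (f : E n → F) : Prop :=
  ∀ i : Fin n, ∃ g : E n → F, HasWeakPartial i f g ∧ MemWLp p σ g

/-- The weighted Sobolev space `H^1_σ(ℝⁿ)`: `f` and its weak gradient belong to `L²_σ(ℝⁿ)`. -/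
def MemH1 {n : ℕ} (σ : ℝ) (f : E n → ℂ) : Prop :=
  MemWLp 2 σ f ∧ WeakGradMemWLp 2 σ f

/-- The range of Lebesgue exponents: `3 ≤ p ≤ ∞` if `n = 3`, and `2 < p ≤ ∞` if `n = 2`. -/
def ExponentOK (n : ℕ) (p : ENNReal) : Prop :=
  (n = 3 ∧ 3 ≤ p) ∨ (n = 2 ∧ 2 < p)

/-- The lower bound `(n + 1)/2 - n/p` for the weight of `L^p_δ(ℝⁿ)`, with `n/∞ = 0`. -/
def weightBound (n : ℕ) (p : ENNReal) : ℝ :=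
  ((n : ℝ) + 1) / 2 - (n : ℝ) * (p⁻¹).toReal

/-- The Hankel function `H_ν^{(1)}(z)` of the first kind for `ν > -1/2` and `z > 0`, in Hankel's
integral form
`H_ν^{(1)}(z) = (2/(π z))^{1/2} e^{i(z - νπ/2 - π/4)} / Γ(ν + 1/2) ·
  ∫₀^∞ e^{-u} u^{ν - 1/2} (1 + i u/(2z))^{ν - 1/2} du` (principal power, real part `1`). -/
def hankel1 (ν z : ℝ) : ℂ :=
  (Real.sqrt (2 / (Real.pi * z)) : ℂ)
    * Complex.exp (Complex.I * ((z - ν * Real.pi / 2 - Real.pi / 4 : ℝ) : ℂ))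
    / (Real.Gamma (ν + 1 / 2) : ℂ)
    * ∫ u in Set.Ioi (0 : ℝ), ((Real.exp (-u) * u ^ (ν - 1 / 2) : ℝ) : ℂ)
        * (1 + Complex.I * ((u / (2 * z) : ℝ) : ℂ)) ^ ((ν - 1 / 2 : ℝ) : ℂ)

/-- The outgoing Green function
`G_κ^+(r) = (i/4) (κ/(2π r))^{(n-2)/2} H^{(1)}_{(n-2)/2}(κ r)`, for `κ > 0` and `r > 0`: the
kernel of `(-Δ - κ² - i0)^{-1}` on `ℝⁿ` as a function of `r = |x - y|`. -/
def greenPlus (n : ℕ) (κ r : ℝ) : ℂ :=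
  Complex.I / 4 * (((κ / (2 * Real.pi * r)) ^ (((n : ℝ) - 2) / 2) : ℝ) : ℂ)
    * hankel1 (((n : ℝ) - 2) / 2) (κ * r)

/-- The function `i ∇·(W f) + i W·∇f - (|W|² + V) f`, with weak derivatives. -/
def source {n : ℕ} (W : E n → E n) (V : E n → ℝ) (f : E n → ℂ) (y : E n) : ℂ :=
  Complex.I * ∑ i, weakPartial i (fun x => (W x i : ℂ) * f x) y
    + Complex.I * ∑ i, (W y i : ℂ) * weakPartial i f y
    - ((‖W y‖ ^ 2 + V y : ℝ) : ℂ) * f y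

/-- The integral operator
`L_k f(x) = ∫ G_k^+(|x-y|) (i ∇·(W f) + i W·∇f - (|W|² + V) f)(y) dy`. The kernel is that of
`(-Δ - k² - i0)^{-1}`, so it depends on `k ≠ 0` through `|k|` only. -/
def Lk {n : ℕ} (k : ℝ) (W : E n → E n) (V : E n → ℝ) (f : E n → ℂ) (x : E n) : ℂ :=
  ∫ y, greenPlus n |k| ‖x - y‖ * source W V f y

/-- `L_k f` is well defined: all weak derivatives in it exist as locally integrable functions, and
the integral converges absolutely for almost every `x`. -/
def LkDefined {n : ℕ} (k : ℝ) (W : E n → E n) (V : E n → ℝ) (f : E n → ℂ) : Prop :=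
  (∀ i, ∃ g, HasWeakPartial i (fun x => (W x i : ℂ) * f x) g) ∧
  (∀ i, ∃ g, HasWeakPartial i f g) ∧
  ∀ᵐ x : E n, Integrable (fun y => greenPlus n |k| ‖x - y‖ * source W V f y) volume

/-- The incident plane wave `u₀(x) = e^{i k (x, θ)}`. -/
def planeWave {n : ℕ} (k : ℝ) (θ x : E n) : ℂ :=
  Complex.exp (Complex.I * ((k * inner ℝ x θ : ℝ) : ℂ))

end MagneticScattering

end

/-! Put `α = (n-1)/2`. Everything happens in `H¹_{-σ}` for one exponent `σ > n/2`, chosen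
independently of `k`. Since `σ > n/2`, plane waves lie in `H¹_{-σ}`, so part (a) is a special case
of part (b).

The source term of an `f` in `H¹_{-σ}` lies in `L¹_{-α} ∩ L²_{-σ}` (`isSource_source`). The `L¹`
half is Hölder's inequality: `A ∈ L^p_s` lies in `L²_{σ-α}` as soon as `σ < s - 1/2 + n/p`, and the
hypothesis on each weight says precisely that this upper bound exceeds `n/2`. So there is room for
`σ`. The `L²` half is Sobolev's inequality: `⟨x⟩^{-σ} f` is in `H¹`, hence in `L^q` with `1/p + 1/q
= 1/2`, because `q ≤ 6` for `n = 3`, `p ≥ 3`, and `q < ∞` for `n = 2`, `p > 2` (`MemH1.smul`). The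
term `W·∇f` needs no Sobolev inequality, as `W` is bounded. The derivative of `W f` comes from a
product rule in `L²_loc`, proved by mollification (`HasWeakPartial.smul`).

The kernel and its radial derivative are both at most a constant times `r^{-α} + r^{-α-1}`
(`kernelBound_greenPlus`). The part with `r ≤ 1` is integrable because `(n+1)/2 < n`, and the weight
hardly changes over distance one, so Young's inequality keeps it in `L²_{-σ}`. The part with `r > 1`
decays only like `⟨x-y⟩^{-α}`. Its square, integrated in `x` against `⟨x⟩^{-2σ}` with `2σ > n`, is
at most a constant times `⟨y⟩^{-2α}`, and a Minkowski-type inequality then uses the `L¹_{-α}` norm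
of the source (`lintegral_kernel_conv_lt_top`). The same estimate for the differentiated kernel
bounds the gradient. That it is the weak gradient follows from Fubini and integration by parts for
the kernel, whose singularity is mild enough to leave no boundary term (`hasWeakPartial_integral`).
-/

open MeasureTheory
open scoped ContDiff

noncomputable section

namespace MagneticScattering

/-! ### Pointwise bounds for the outgoing Green function and its derivative. -/

section Green

/-- A function on `(0, ∞)` of at most the size of an outgoing wave `r^{-α} e^{iκr}`, up to a
singularity `r^{-α-1}` at the origin, together with its derivative. -/
structure KernelBound (α : ℝ) (G G' : ℝ → ℂ) (C : ℝ) : Prop where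
  zero : G 0 = 0
  hasDerivAt : ∀ r, 0 < r → HasDerivAt G (G' r) r
  continuousOn : ContinuousOn G' (Set.Ioi 0)
  norm_le : ∀ r, 0 < r → ‖G r‖ ≤ C * (r ^ (-α) + r ^ (-α - 1))
  norm_deriv_le : ∀ r, 0 < r → ‖G' r‖ ≤ C * (r ^ (-α) + r ^ (-α - 1))

/-- The amplitude `J` behaves like a symbol of order zero. Differentiating the exponential costs the
constant `κ`; differentiating the power or `J` gains a factor `r⁻¹`. Hence the derivative obeys the
same two-power bound as the function. -/
lemma kernelBound_of_amplitude {α κ M : ℝ} (hα : 0 < α) (hκ : 0 < κ) (hM : 0 ≤ M) (c : ℂ)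
    {G J J' : ℝ → ℂ} (hG0 : G 0 = 0)
    (hG : ∀ r, 0 < r → G r = c * ((r ^ (-α) : ℝ) : ℂ) * Complex.exp (Complex.I * (κ * r : ℝ)) * J r)
    (hJ : ∀ r, 0 < r → HasDerivAt J (J' r) r) (hJc : ContinuousOn J' (Set.Ioi 0))
    (hJb : ∀ r, 0 < r → ‖J r‖ ≤ M) (hJb' : ∀ r, 0 < r → ‖J' r‖ ≤ M * r⁻¹) :
    ∃ G' C, 0 ≤ C ∧ KernelBound α G G' C := by
  have hexp : ∀ r : ℝ, HasDerivAt (fun r : ℝ => Complex.exp (Complex.I * (κ * r : ℝ)))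
      (Complex.exp (Complex.I * (κ * r : ℝ)) * (Complex.I * (κ : ℂ))) r := by
    intro r
    have h1 : HasDerivAt (fun r : ℝ => Complex.I * ((κ * r : ℝ) : ℂ)) (Complex.I * (κ : ℂ)) r := by
      have := ((hasDerivAt_id r).const_mul κ).ofReal_comp.const_mul Complex.I
      simpa using this
    exact h1.cexp
  have hpow : ∀ r : ℝ, 0 < r → HasDerivAt (fun r : ℝ => ((r ^ (-α) : ℝ) : ℂ))
      ((-α * r ^ (-α - 1) : ℝ) : ℂ) r := by
    intro r hr
    exact (Real.hasDerivAt_rpow_const (Or.inl hr.ne')).ofReal_comp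
  have hne : ∀ r : ℝ, ‖Complex.exp (Complex.I * (κ * r : ℝ))‖ = 1 := by
    intro r
    rw [mul_comm, Complex.norm_exp_ofReal_mul_I]
  refine ⟨fun r => c * ((-α * r ^ (-α - 1) : ℝ) : ℂ) * Complex.exp (Complex.I * (κ * r : ℝ)) * J r
      + c * ((r ^ (-α) : ℝ) : ℂ) * (Complex.exp (Complex.I * (κ * r : ℝ)) * (Complex.I * (κ : ℂ)))
        * J r
      + c * ((r ^ (-α) : ℝ) : ℂ) * Complex.exp (Complex.I * (κ * r : ℝ)) * J' r,
    ‖c‖ * M * (1 + α + κ), by positivity, hG0, ?_, ?_, ?_, ?_⟩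
  · intro r hr
    have h := (((hpow r hr).const_mul c).mul (hexp r)).mul (hJ r hr)
    refine (h.congr_of_eventuallyEq ?_).congr_deriv ?_
    · filter_upwards [lt_mem_nhds hr] with s hs
      simpa using hG s hs
    · simp only [Pi.mul_apply]; ring
  · have hJ1 : ContinuousOn J (Set.Ioi 0) := fun r hr => (hJ r hr).continuousAt.continuousWithinAt
    have h1 : ContinuousOn (fun r : ℝ => ((-α * r ^ (-α - 1) : ℝ) : ℂ)) (Set.Ioi 0) := by
      refine Complex.continuous_ofReal.comp_continuousOn (continuousOn_const.mul ?_)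
      exact fun r hr => (Real.continuousAt_rpow_const _ _
        (Or.inl (ne_of_gt hr))).continuousWithinAt
    have h2 : ContinuousOn (fun r : ℝ => ((r ^ (-α) : ℝ) : ℂ)) (Set.Ioi 0) :=
      fun r hr => (hpow r hr).continuousAt.continuousWithinAt
    have h3 : Continuous (fun r : ℝ => Complex.exp (Complex.I * (κ * r : ℝ))) := by fun_prop
    have h3 := h3.continuousOn (s := Set.Ioi 0)
    fun_prop
  · intro r hr
    have hr1 : 0 < r ^ (-α) := Real.rpow_pos_of_pos hr _
    have hr2 : 0 < r ^ (-α - 1) := Real.rpow_pos_of_pos hr _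
    rw [hG r hr, norm_mul, norm_mul, norm_mul, hne, Complex.norm_real, Real.norm_of_nonneg hr1.le]
    calc ‖c‖ * r ^ (-α) * 1 * ‖J r‖ ≤ ‖c‖ * r ^ (-α) * 1 * M := by gcongr; exact hJb r hr
      _ = ‖c‖ * M * 1 * r ^ (-α) := by ring
      _ ≤ ‖c‖ * M * (1 + α + κ) * (r ^ (-α) + r ^ (-α - 1)) := by
        gcongr <;> linarith
  · intro r hr
    have hr1 : 0 < r ^ (-α) := Real.rpow_pos_of_pos hr _
    have hr2 : 0 < r ^ (-α - 1) := Real.rpow_pos_of_pos hr _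
    have hrr : r ^ (-α) * r⁻¹ = r ^ (-α - 1) := by
      rw [Real.rpow_sub_one hr.ne', div_eq_mul_inv]
    refine (norm_add₃_le).trans ?_
    simp only [norm_mul, hne, Complex.norm_real, Complex.norm_I, norm_neg, Real.norm_of_nonneg hr1.le,
      Real.norm_of_nonneg hr2.le, Real.norm_of_nonneg hα.le, Real.norm_of_nonneg hκ.le]
    calc _ ≤ ‖c‖ * (α * r ^ (-α - 1)) * 1 * M + ‖c‖ * r ^ (-α) * (1 * (1 * κ)) * M
          + ‖c‖ * r ^ (-α) * 1 * (M * r⁻¹) := by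
          gcongr
          · exact hJb r hr
          · exact hJb r hr
          · exact hJb' r hr
      _ = ‖c‖ * M * (α * r ^ (-α - 1) + κ * r ^ (-α) + r ^ (-α) * r⁻¹) := by ring
      _ = ‖c‖ * M * ((1 + α) * r ^ (-α - 1) + κ * r ^ (-α)) := by rw [hrr]; ring
      _ ≤ ‖c‖ * M * ((1 + α + κ) * r ^ (-α - 1) + (1 + α + κ) * r ^ (-α)) := by
        refine mul_le_mul_of_nonneg_left (add_le_add ?_ ?_) (by positivity)
        · exact mul_le_mul_of_nonneg_right (by linarith) hr2.le
        · exact mul_le_mul_of_nonneg_right (by linarith) hr1.le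
      _ = _ := by ring

/-- With division by zero equal to zero, the factor `sqrt (2 / (π κ r))` vanishes at `r = 0`.
Negative powers of zero are zero as well, so the kernel bounds hold at the origin without an
exception. -/
lemma greenPlus_zero {n : ℕ} (κ : ℝ) : greenPlus n κ 0 = 0 := by
  simp [greenPlus, hankel1]

lemma exp_phase (a b : ℝ) : Complex.exp (Complex.I * ((a - b : ℝ) : ℂ)) =
    Complex.exp (Complex.I * (a : ℝ)) * Complex.exp (-(Complex.I * (b : ℝ))) := by
  rw [← Complex.exp_add]; congr 1; push_cast; ring

lemma sqrt_two_div_mul {κ r : ℝ} (hκ : 0 < κ) (hr : 0 < r) :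
    Real.sqrt (2 / (Real.pi * (κ * r))) = Real.sqrt (2 / (Real.pi * κ)) * r ^ (-(1 / 2) : ℝ) := by
  rw [Real.rpow_neg hr.le, ← Real.sqrt_eq_rpow, ← Real.sqrt_inv, ← Real.sqrt_mul (by positivity)]
  congr 1; field_simp

/-- For `ν = 1/2` the binomial in Hankel's integral has exponent zero and the integral is `Γ(1) =
1`. The amplitude is constant: this is the kernel `e^{iκr} / (4πr)`. -/
lemma kernelBound_greenPlus_three {κ : ℝ} (hκ : 0 < κ) :
    ∃ G' C, 0 ≤ C ∧ KernelBound 1 (greenPlus 3 κ) G' C := by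
  refine kernelBound_of_amplitude one_pos hκ zero_le_one
    (Complex.I / 4 * ((Real.sqrt (κ / (2 * Real.pi)) * Real.sqrt (2 / (Real.pi * κ)) : ℝ) : ℂ)
      * Complex.exp (-(Complex.I * ((1 / 2 * Real.pi / 2 + Real.pi / 4 : ℝ) : ℂ))))
    (J := fun _ => 1) (J' := fun _ => 0)
    (greenPlus_zero κ) ?_ (fun r _ => hasDerivAt_const r 1) continuousOn_const (by simp)
    (by intro r hr; simpa using hr.le)
  intro r hr
  have h1 : (((3 : ℕ) : ℝ) - 2) / 2 = 1 / 2 := by norm_num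
  have h2 : (κ / (2 * Real.pi * r)) ^ (1 / 2 : ℝ)
      = Real.sqrt (κ / (2 * Real.pi)) * r ^ (-(1 / 2) : ℝ) := by
    rw [← Real.sqrt_eq_rpow, Real.rpow_neg hr.le, ← Real.sqrt_eq_rpow, ← Real.sqrt_inv,
      ← Real.sqrt_mul (by positivity)]
    congr 1; field_simp
  have h3 : r ^ (-1 : ℝ) = r ^ (-(1 / 2) : ℝ) * r ^ (-(1 / 2) : ℝ) := by
    rw [← Real.rpow_add hr]; norm_num
  have h4 : ∫ u in Set.Ioi (0 : ℝ), ((Real.exp (-u) : ℝ) : ℂ) = 1 := by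
    rw [integral_complex_ofReal, integral_exp_neg_Ioi_zero]; simp
  unfold greenPlus hankel1
  rw [h1, h2, sqrt_two_div_mul hκ hr, sub_sub, exp_phase, h3]
  have h5 : (1 / 2 : ℝ) - 1 / 2 = 0 := by norm_num
  have h6 : (1 / 2 : ℝ) + 1 / 2 = 1 := by norm_num
  simp only [h5, h6, Real.rpow_zero, mul_one, Complex.ofReal_zero, Complex.cpow_zero,
    Real.Gamma_one, Complex.ofReal_one, div_one, h4]
  push_cast
  ring

lemma one_le_norm_one_add_I_mul (t : ℝ) : 1 ≤ ‖1 + Complex.I * (t : ℂ)‖ := by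
  have := Complex.abs_re_le_norm (1 + Complex.I * (t : ℂ))
  simpa using this

lemma abs_le_norm_one_add_I_mul (t : ℝ) : |t| ≤ ‖1 + Complex.I * (t : ℂ)‖ := by
  have := Complex.abs_im_le_norm (1 + Complex.I * (t : ℂ))
  simpa using this

lemma one_add_I_mul_mem_slitPlane (t : ℝ) : 1 + Complex.I * (t : ℂ) ∈ Complex.slitPlane := by
  left; simp

/-- The integrand of Hankel's integral of order `0`. -/
def hankelIntegrand (z u : ℝ) : ℂ :=
  ((Real.exp (-u) * u ^ (0 - 1 / 2 : ℝ) : ℝ) : ℂ)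
    * (1 + Complex.I * ((u / (2 * z) : ℝ) : ℂ)) ^ ((0 - 1 / 2 : ℝ) : ℂ)

/-- The derivative in `z` of `hankelIntegrand`. -/
def hankelIntegrandDeriv (z u : ℝ) : ℂ :=
  ((Real.exp (-u) * u ^ (0 - 1 / 2 : ℝ) : ℝ) : ℂ)
    * (((0 - 1 / 2 : ℝ) : ℂ) * (1 + Complex.I * ((u / (2 * z) : ℝ) : ℂ)) ^ (((0 - 1 / 2 : ℝ) : ℂ) - 1)
      * (Complex.I * ((-(u / (2 * z ^ 2)) : ℝ) : ℂ)))

lemma integrableOn_exp_neg_mul_rpow :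
    IntegrableOn (fun u : ℝ => Real.exp (-u) * u ^ (0 - 1 / 2 : ℝ)) (Set.Ioi 0) := by
  have := Real.GammaIntegral_convergent (s := 1 / 2) (by norm_num)
  convert this using 3
  norm_num

lemma norm_hankelIntegrand_le {z u : ℝ} (hu : 0 < u) :
    ‖hankelIntegrand z u‖ ≤ Real.exp (-u) * u ^ (0 - 1 / 2 : ℝ) := by
  unfold hankelIntegrand
  rw [norm_mul, Complex.norm_real, Real.norm_of_nonneg (by positivity)]
  refine mul_le_of_le_one_right (by positivity) ?_
  rw [Complex.norm_cpow_real]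
  exact Real.rpow_le_one_of_one_le_of_nonpos (one_le_norm_one_add_I_mul _) (by norm_num)

/-- Differentiation in `z` produces `u / z²` times the power `-3/2` of `1 + iu/(2z)`. Since `|1 +
it| ≥ max(1, |t|)`, that power is at most `2z/u`, which cancels the growth in `u` and one factor
`z⁻¹`. -/
lemma norm_hankelIntegrandDeriv_le {z u : ℝ} (hz : 0 < z) (hu : 0 < u) :
    ‖hankelIntegrandDeriv z u‖ ≤ Real.exp (-u) * u ^ (0 - 1 / 2 : ℝ) * z⁻¹ := by
  unfold hankelIntegrandDeriv
  have h1 : (((0 - 1 / 2 : ℝ) : ℂ) - 1) = ((-(3 / 2) : ℝ) : ℂ) := by push_cast; norm_num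
  rw [norm_mul, Complex.norm_real, Real.norm_of_nonneg (by positivity), h1]
  refine mul_le_mul_of_nonneg_left ?_ (by positivity)
  rw [norm_mul, norm_mul, norm_mul, Complex.norm_cpow_real, Complex.norm_I, Complex.norm_real,
    Complex.norm_real, norm_neg, Real.norm_of_nonneg (by positivity : 0 ≤ u / (2 * z ^ 2))]
  have h2 : ‖1 + Complex.I * ((u / (2 * z) : ℝ) : ℂ)‖ ^ (-(3 / 2) : ℝ) ≤ (u / (2 * z))⁻¹ := by
    calc _ ≤ ‖1 + Complex.I * ((u / (2 * z) : ℝ) : ℂ)‖ ^ (-1 : ℝ) :=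
          Real.rpow_le_rpow_of_exponent_le (one_le_norm_one_add_I_mul _) (by norm_num)
      _ ≤ (u / (2 * z)) ^ (-1 : ℝ) := by
          refine Real.rpow_le_rpow_of_nonpos (by positivity) ?_ (by norm_num)
          exact (le_abs_self _).trans (abs_le_norm_one_add_I_mul _)
      _ = _ := Real.rpow_neg_one _
  have h3 : ‖(0 - 1 / 2 : ℝ)‖ = 1 / 2 := by norm_num [abs_of_pos]
  rw [h3]
  calc _ ≤ 1 / 2 * (u / (2 * z))⁻¹ * (1 * (u / (2 * z ^ 2))) := by gcongr
    _ = 1 / 2 * z⁻¹ := by field_simp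
    _ ≤ z⁻¹ := by have := inv_pos.mpr hz; linarith

lemma hasDerivAt_hankelIntegrand {z : ℝ} (hz : 0 < z) (u : ℝ) :
    HasDerivAt (fun z => hankelIntegrand z u) (hankelIntegrandDeriv z u) z := by
  have h1 : HasDerivAt (fun z : ℝ => u / (2 * z)) (-(u / (2 * z ^ 2))) z := by
    have := ((hasDerivAt_id z).const_mul 2).fun_inv (by simpa using hz.ne')
    have := this.const_mul u
    refine (this.congr_deriv ?_)
    simp; field_simp
  have h2 : HasDerivAt (fun z : ℝ => 1 + Complex.I * ((u / (2 * z) : ℝ) : ℂ))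
      (Complex.I * ((-(u / (2 * z ^ 2)) : ℝ) : ℂ)) z :=
    (h1.ofReal_comp.const_mul Complex.I).const_add 1
  exact ((Complex.hasStrictDerivAt_cpow_const
    (one_add_I_mul_mem_slitPlane (u / (2 * z)))).hasDerivAt.comp z h2).const_mul _

lemma continuousOn_rpow_Ioi (a : ℝ) : ContinuousOn (fun u : ℝ => u ^ a) (Set.Ioi 0) :=
  fun _ hu => (Real.continuousAt_rpow_const _ _ (Or.inl (ne_of_gt hu))).continuousWithinAt

lemma continuous_one_add_I_mul_cpow {X : Type*} [TopologicalSpace X] {f : X → ℝ} {s : Set X}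
    (hf : ContinuousOn f s) (a : ℂ) : ContinuousOn (fun x => (1 + Complex.I * (f x : ℂ)) ^ a) s := by
  refine ContinuousOn.cpow_const ?_ (fun x _ => one_add_I_mul_mem_slitPlane _)
  fun_prop

lemma aestronglyMeasurable_hankelIntegrand (z : ℝ) :
    AEStronglyMeasurable (hankelIntegrand z) (volume.restrict (Set.Ioi 0)) := by
  refine ContinuousOn.aestronglyMeasurable ?_ measurableSet_Ioi
  have h1 := continuousOn_rpow_Ioi (0 - 1 / 2)
  have h2 := continuous_one_add_I_mul_cpow (f := fun u : ℝ => u / (2 * z)) (s := Set.Ioi 0)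
    (by fun_prop) ((0 - 1 / 2 : ℝ) : ℂ)
  unfold hankelIntegrand
  fun_prop

lemma aestronglyMeasurable_hankelIntegrandDeriv (z : ℝ) :
    AEStronglyMeasurable (hankelIntegrandDeriv z) (volume.restrict (Set.Ioi 0)) := by
  refine ContinuousOn.aestronglyMeasurable ?_ measurableSet_Ioi
  have h1 := continuousOn_rpow_Ioi (0 - 1 / 2)
  have h2 := continuous_one_add_I_mul_cpow (f := fun u : ℝ => u / (2 * z)) (s := Set.Ioi 0)
    (by fun_prop) (((0 - 1 / 2 : ℝ) : ℂ) - 1)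
  unfold hankelIntegrandDeriv
  fun_prop

lemma continuousOn_hankelIntegrandDeriv (u : ℝ) :
    ContinuousOn (fun z => hankelIntegrandDeriv z u) (Set.Ioi 0) := by
  have h0 : ∀ z ∈ Set.Ioi (0 : ℝ), 2 * z ≠ 0 := fun z hz => by
    have : (0 : ℝ) < z := hz
    positivity
  have h0' : ∀ z ∈ Set.Ioi (0 : ℝ), 2 * z ^ 2 ≠ 0 := fun z hz => by
    have : (0 : ℝ) < z := hz
    positivity
  have h2 := continuous_one_add_I_mul_cpow (f := fun z : ℝ => u / (2 * z)) (s := Set.Ioi 0)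
    (continuousOn_const.div (by fun_prop) h0) (((0 - 1 / 2 : ℝ) : ℂ) - 1)
  have h3 : ContinuousOn (fun z : ℝ => -(u / (2 * z ^ 2))) (Set.Ioi 0) :=
    (continuousOn_const.div (by fun_prop) h0').neg
  unfold hankelIntegrandDeriv
  fun_prop

lemma hasDerivAt_hankelIntegral {z : ℝ} (hz : 0 < z) :
    HasDerivAt (fun z => ∫ u in Set.Ioi (0 : ℝ), hankelIntegrand z u)
      (∫ u in Set.Ioi (0 : ℝ), hankelIntegrandDeriv z u) z := by
  have hz2 : 0 < z / 2 := by positivity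
  -- On the neighbourhood `(z/2, ∞)` the factor `z⁻¹` stays below `(z/2)⁻¹`, which makes the
  -- majorant uniform.
  refine (hasDerivAt_integral_of_dominated_loc_of_deriv_le (s := Set.Ioi (z / 2))
    (bound := fun u => Real.exp (-u) * u ^ (0 - 1 / 2 : ℝ) * (z / 2)⁻¹)
    (Ioi_mem_nhds (by linarith)) ?_ ?_ ?_ ?_ ?_ ?_).2
  · exact Filter.Eventually.of_forall aestronglyMeasurable_hankelIntegrand
  · refine integrableOn_exp_neg_mul_rpow.mono' (aestronglyMeasurable_hankelIntegrand z) ?_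
    exact (ae_restrict_mem measurableSet_Ioi).mono fun u hu => norm_hankelIntegrand_le hu
  · exact aestronglyMeasurable_hankelIntegrandDeriv z
  · refine (ae_restrict_mem measurableSet_Ioi).mono fun u hu y hy => ?_
    have hu : 0 < u := hu
    have hy : z / 2 < y := hy
    refine (norm_hankelIntegrandDeriv_le (hz2.trans hy) hu).trans ?_
    gcongr
  · exact integrableOn_exp_neg_mul_rpow.mul_const _
  · exact Filter.Eventually.of_forall fun u y hy => hasDerivAt_hankelIntegrand (hz2.trans hy) u

lemma continuousOn_hankelIntegral_deriv :
    ContinuousOn (fun z => ∫ u in Set.Ioi (0 : ℝ), hankelIntegrandDeriv z u) (Set.Ioi 0) := by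
  intro z hz
  have hz : 0 < z := hz
  have hz2 : 0 < z / 2 := by positivity
  refine ContinuousAt.continuousWithinAt (continuousAt_of_dominated
    (bound := fun u => Real.exp (-u) * u ^ (0 - 1 / 2 : ℝ) * (z / 2)⁻¹) ?_ ?_ ?_ ?_)
  · exact Filter.Eventually.of_forall aestronglyMeasurable_hankelIntegrandDeriv
  · filter_upwards [lt_mem_nhds (show z / 2 < z by linarith)] with y hy
    refine (ae_restrict_mem measurableSet_Ioi).mono fun u hu => ?_
    have hu : 0 < u := hu
    refine (norm_hankelIntegrandDeriv_le (hz2.trans hy) hu).trans ?_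
    gcongr
  · exact integrableOn_exp_neg_mul_rpow.mul_const _
  · exact Filter.Eventually.of_forall fun u =>
      (continuousOn_hankelIntegrandDeriv u).continuousAt (Ioi_mem_nhds hz)

/-- The power of `κ/(2πr)` is trivial, so all the decay `r^{-1/2}` comes from the prefactor of the
Hankel function. The true singularity at the origin is logarithmic; the cruder bound is enough. -/
lemma kernelBound_greenPlus_two {κ : ℝ} (hκ : 0 < κ) :
    ∃ G' C, 0 ≤ C ∧ KernelBound (1 / 2) (greenPlus 2 κ) G' C := by
  set M := ∫ u in Set.Ioi (0 : ℝ), Real.exp (-u) * u ^ (0 - 1 / 2 : ℝ) with hM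
  have hM0 : 0 ≤ M := setIntegral_nonneg measurableSet_Ioi fun u hu => by
    have : 0 < u := hu
    positivity
  refine kernelBound_of_amplitude (M := M) (by norm_num) hκ hM0
    (Complex.I / 4 * (Real.sqrt (2 / (Real.pi * κ)) : ℂ)
      * Complex.exp (-(Complex.I * ((0 * Real.pi / 2 + Real.pi / 4 : ℝ) : ℂ)))
      / (Real.Gamma (0 + 1 / 2) : ℂ))
    (J := fun r => ∫ u in Set.Ioi (0 : ℝ), hankelIntegrand (κ * r) u)
    (J' := fun r => κ * ∫ u in Set.Ioi (0 : ℝ), hankelIntegrandDeriv (κ * r) u)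
    (greenPlus_zero κ) ?_ ?_ ?_ ?_ ?_
  · intro r hr
    have h1 : (((2 : ℕ) : ℝ) - 2) / 2 = 0 := by norm_num
    unfold greenPlus hankel1
    rw [h1, Real.rpow_zero, sqrt_two_div_mul hκ hr, sub_sub, exp_phase]
    simp only [hankelIntegrand]
    push_cast
    ring
  · intro r hr
    have h1 : HasDerivAt (fun r : ℝ => κ * r) κ r := by
      simpa using (hasDerivAt_id r).const_mul κ
    have := (hasDerivAt_hankelIntegral (mul_pos hκ hr)).scomp r h1
    exact this.congr_deriv (by simp)
  · refine continuousOn_const.mul (continuousOn_hankelIntegral_deriv.comp (by fun_prop) ?_)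
    exact fun r hr => mul_pos hκ hr
  · intro r hr
    refine norm_integral_le_of_norm_le integrableOn_exp_neg_mul_rpow ?_
    exact (ae_restrict_mem measurableSet_Ioi).mono fun u hu => norm_hankelIntegrand_le hu
  · intro r hr
    have h := norm_integral_le_of_norm_le (μ := volume.restrict (Set.Ioi (0 : ℝ)))
      (f := hankelIntegrandDeriv (κ * r))
      (integrableOn_exp_neg_mul_rpow.mul_const (κ * r)⁻¹)
      ((ae_restrict_mem measurableSet_Ioi).mono fun u hu =>
        norm_hankelIntegrandDeriv_le (mul_pos hκ hr) hu)
    rw [integral_mul_const, ← hM] at h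
    rw [norm_mul, Complex.norm_real, Real.norm_of_nonneg hκ.le]
    calc _ ≤ κ * (M * (κ * r)⁻¹) := by gcongr
      _ = M * r⁻¹ := by field_simp

/-- The outgoing Green function and its derivative decay like `r^{-(n-1)/2}` and are at most as
singular as `r^{-(n+1)/2}`. -/
lemma kernelBound_greenPlus {n : ℕ} (hn : n = 2 ∨ n = 3) {κ : ℝ} (hκ : 0 < κ) :
    ∃ G' C, 0 ≤ C ∧ KernelBound (((n : ℝ) - 1) / 2) (greenPlus n κ) G' C := by
  rcases hn with rfl | rfl
  · convert kernelBound_greenPlus_two hκ using 5; norm_num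
  · convert kernelBound_greenPlus_three hκ using 5; norm_num

end Green

/-! ### Japanese bracket weights and weighted Hölder inequalities. -/

section Weights

variable {n : ℕ} {F : Type*} [NormedAddCommGroup F] [NormedSpace ℝ F]

/-- The weight `⟨x⟩^σ = (1 + |x|²)^{σ/2}`. -/
def bracket (σ : ℝ) (x : E n) : ℝ := (1 + ‖x‖ ^ 2) ^ (σ / 2)

lemma one_add_norm_sq_pos (x : E n) : 0 < 1 + ‖x‖ ^ 2 := by positivity

lemma bracket_pos (σ : ℝ) (x : E n) : 0 < bracket σ x := Real.rpow_pos_of_pos (by positivity) _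

lemma bracket_add (σ τ : ℝ) (x : E n) : bracket (σ + τ) x = bracket σ x * bracket τ x := by
  rw [bracket, add_div, Real.rpow_add (one_add_norm_sq_pos x)]; rfl

lemma bracket_zero (x : E n) : bracket 0 x = 1 := by simp [bracket]

lemma bracket_neg_mul (σ : ℝ) (x : E n) : bracket (-σ) x * bracket σ x = 1 := by
  rw [← bracket_add, neg_add_cancel, bracket_zero]

lemma bracket_mono {σ τ : ℝ} (h : σ ≤ τ) (x : E n) : bracket σ x ≤ bracket τ x :=
  Real.rpow_le_rpow_of_exponent_le (by nlinarith [sq_nonneg ‖x‖]) (by linarith)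

lemma continuous_bracket (σ : ℝ) : Continuous (bracket σ : E n → ℝ) :=
  Continuous.rpow_const (by fun_prop) fun x => Or.inl (one_add_norm_sq_pos x).ne'

lemma contDiff_bracket (σ : ℝ) : ContDiff ℝ ∞ (bracket σ : E n → ℝ) :=
  ContDiff.rpow_const_of_ne (contDiff_const.add (contDiff_norm_sq ℝ))
    fun x => (one_add_norm_sq_pos x).ne'

/-- Differentiating the weight costs no more than a constant multiple of the weight, because `|x| ≤
1 + |x|²`. So `⟨x⟩^{-σ} f` is in the unweighted `H¹` when `f` is in `H¹_{-σ}`. -/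
lemma abs_fderiv_bracket_le (σ : ℝ) (x v : E n) :
    |fderiv ℝ (bracket σ) x v| ≤ |σ| * bracket σ x * ‖v‖ := by
  have h1 : HasFDerivAt (fun x : E n => 1 + ‖x‖ ^ 2) (2 • (innerSL ℝ x)) x :=
    (hasStrictFDerivAt_norm_sq x).hasFDerivAt.const_add 1
  have h2 := h1.rpow_const (p := σ / 2) (Or.inl (one_add_norm_sq_pos x).ne')
  have h3 : fderiv ℝ (bracket σ) x = _ := h2.fderiv
  rw [h3]
  have hp := one_add_norm_sq_pos x
  simp only [_root_.smul_apply, smul_eq_mul, nsmul_eq_mul, innerSL_apply_apply,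
    Nat.cast_ofNat]
  have h4 : |inner ℝ x v| ≤ (1 + ‖x‖ ^ 2) * ‖v‖ := by
    refine (abs_real_inner_le_norm x v).trans ?_
    gcongr
    nlinarith [sq_nonneg (‖x‖ - 1), sq_nonneg ‖x‖]
  have h5 : (1 + ‖x‖ ^ 2) ^ (σ / 2 - 1) * (1 + ‖x‖ ^ 2) = bracket σ x := by
    rw [Real.rpow_sub_one hp.ne', div_mul_cancel₀ _ hp.ne']; rfl
  have h6 : 0 < (1 + ‖x‖ ^ 2) ^ (σ / 2 - 1) := Real.rpow_pos_of_pos hp _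
  calc |σ / 2 * (1 + ‖x‖ ^ 2) ^ (σ / 2 - 1) * (2 * inner ℝ x v)|
      = |σ| * (1 + ‖x‖ ^ 2) ^ (σ / 2 - 1) * |inner ℝ x v| := by
        rw [abs_mul, abs_mul, abs_mul, abs_div, abs_of_pos h6, abs_two]; ring
    _ ≤ |σ| * (1 + ‖x‖ ^ 2) ^ (σ / 2 - 1) * ((1 + ‖x‖ ^ 2) * ‖v‖) := by gcongr
    _ = |σ| * ((1 + ‖x‖ ^ 2) ^ (σ / 2 - 1) * (1 + ‖x‖ ^ 2)) * ‖v‖ := by ring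
    _ = _ := by rw [h5]

/-- The weight is slowly varying. -/
lemma bracket_neg_le_of_norm_sub_le_one {σ : ℝ} (hσ : 0 ≤ σ) {x y : E n} (h : ‖x - y‖ ≤ 1) :
    bracket (-σ) x ≤ 3 ^ (σ / 2) * bracket (-σ) y := by
  have h1 : ‖y‖ ≤ ‖x‖ + 1 := by
    have := norm_sub_norm_le y x
    rw [norm_sub_rev] at this; linarith
  have h2 : 1 + ‖y‖ ^ 2 ≤ 3 * (1 + ‖x‖ ^ 2) := by
    nlinarith [norm_nonneg x, norm_nonneg y, sq_nonneg (‖x‖ - 1)]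
  have h3 : bracket σ y ≤ 3 ^ (σ / 2) * bracket σ x := by
    unfold bracket
    rw [← Real.mul_rpow (by norm_num) (one_add_norm_sq_pos x).le]
    exact Real.rpow_le_rpow (one_add_norm_sq_pos y).le h2 (by linarith)
  have hx := bracket_neg_mul σ x
  have hy := bracket_neg_mul σ y
  have hpx := bracket_pos (-σ) x
  have hpy := bracket_pos (-σ) y
  calc bracket (-σ) x = bracket (-σ) x * bracket (-σ) y * bracket σ y := by
        rw [mul_assoc, hy, mul_one]
    _ ≤ bracket (-σ) x * bracket (-σ) y * (3 ^ (σ / 2) * bracket σ x) := by gcongr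
    _ = 3 ^ (σ / 2) * bracket (-σ) y * (bracket (-σ) x * bracket σ x) := by ring
    _ = _ := by rw [hx, mul_one]

lemma bracket_le_add {σ : ℝ} (hσ : 0 ≤ σ) (x y : E n) :
    bracket σ y ≤ 4 ^ (σ / 2) * (bracket σ x + bracket σ (x - y)) := by
  have h0 : ‖y‖ ≤ ‖x‖ + ‖x - y‖ := by
    have := norm_sub_norm_le y x
    rw [norm_sub_rev] at this; linarith
  -- From `|y| ≤ a + b ≤ 2b` follows `1 + |y|² ≤ 4(1 + b²)`; this is the source of the constant 4.
  have key : ∀ a b : ℝ, 0 ≤ a → 0 ≤ b → ‖y‖ ≤ a + b → a ≤ b →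
      (1 + ‖y‖ ^ 2) ^ (σ / 2) ≤ 4 ^ (σ / 2) * (1 + b ^ 2) ^ (σ / 2) := by
    intro a b ha hb hy hab
    rw [← Real.mul_rpow (by norm_num) (by positivity)]
    refine Real.rpow_le_rpow (by positivity) ?_ (by linarith)
    nlinarith [norm_nonneg y]
  rcases le_total ‖x‖ ‖x - y‖ with h | h
  · refine (key _ _ (norm_nonneg _) (norm_nonneg _) h0 h).trans ?_
    have := bracket_pos σ x
    gcongr
    unfold bracket at *; linarith
  · refine (key _ _ (norm_nonneg _) (norm_nonneg _) (by linarith) h).trans ?_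
    have := bracket_pos σ (x - y)
    gcongr
    unfold bracket at *; linarith

lemma integrable_bracket {s : ℝ} (hs : n < s) : Integrable (bracket (-s) : E n → ℝ) := by
  have := integrable_rpow_neg_one_add_norm_sq (E := E n) (μ := volume) (r := s) (by simpa using hs)
  exact this

lemma bracket_rpow (σ t : ℝ) (x : E n) : bracket σ x ^ t = bracket (σ * t) x := by
  unfold bracket
  rw [← Real.rpow_mul (one_add_norm_sq_pos x).le]; congr 1; ring

lemma memWLp_iff {p : ENNReal} {σ : ℝ} {f : E n → F} :
    MemWLp p σ f ↔ MemLp (fun x => bracket σ x • f x) p volume := Iff.rfl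

lemma memLp_bracket {τ q : ℝ} (hq : 0 < q) (h : n < τ * q) :
    MemLp (bracket (-τ) : E n → ℝ) (ENNReal.ofReal q) volume := by
  have h1 : ENNReal.ofReal q ≠ 0 := by simpa using hq
  rw [← integrable_norm_rpow_iff (continuous_bracket _).aestronglyMeasurable h1
    ENNReal.ofReal_ne_top]
  refine (integrable_bracket h).congr (Filter.Eventually.of_forall fun x => ?_)
  simp only
  rw [Real.norm_of_nonneg (bracket_pos _ _).le, ENNReal.toReal_ofReal hq.le, bracket_rpow]
  congr 1; ring

/-- The exponent `q` with `1/p + 1/q = 1/2`. -/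
lemma holderTriple_two {p : ENNReal} (hp : 2 < p) :
    0 < 1 / 2 - (p⁻¹).toReal ∧
      ENNReal.HolderTriple p (ENNReal.ofReal (1 / 2 - (p⁻¹).toReal)⁻¹) 2 := by
  have hp' : p⁻¹ < 2⁻¹ := ENNReal.inv_lt_inv.2 hp
  have hfin : p⁻¹ ≠ ⊤ := (hp'.trans_le le_top).ne
  set c : ℝ := 1 / 2 - (p⁻¹).toReal with hc
  have h2 : (2⁻¹ : ENNReal) = ENNReal.ofReal (1 / 2) := by
    rw [one_div, ENNReal.ofReal_inv_of_pos (by norm_num)]; simp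
  have hc0 : 0 < c := by
    have := (ENNReal.toReal_lt_toReal hfin (by simp)).2 hp'
    simp at this
    rw [hc, sub_pos]; simpa using this
  refine ⟨hc0, ⟨?_⟩⟩
  rw [ENNReal.ofReal_inv_of_pos hc0, inv_inv, h2, ← ENNReal.ofReal_toReal hfin,
      ← ENNReal.ofReal_add ENNReal.toReal_nonneg hc0.le]
  congr 1; rw [hc]; ring

namespace MemWLp

variable {p : ENNReal} {σ τ : ℝ} {f : E n → F}

lemma aestronglyMeasurable (hf : MemWLp p σ f) : AEStronglyMeasurable f volume := by
  have h := (continuous_bracket (-σ) (n := n)).aestronglyMeasurable (μ := volume).smul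
    (memWLp_iff.1 hf).aestronglyMeasurable
  refine h.congr (Filter.Eventually.of_forall fun x => ?_)
  simp only [Pi.smul_apply', smul_smul, bracket_neg_mul, one_smul]

lemma of_le {F' : Type*} [NormedAddCommGroup F'] [NormedSpace ℝ F'] {g : E n → F'} {C : ℝ}
    (hf : MemWLp p τ f) (hσ : σ ≤ τ)
    (hg : AEStronglyMeasurable g volume) (h : ∀ᵐ x, ‖g x‖ ≤ C * ‖f x‖) : MemWLp p σ g := by
  refine MemLp.of_le_mul (c := C) (memWLp_iff.1 hf)
    ((continuous_bracket σ).aestronglyMeasurable.smul hg) ?_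
  filter_upwards [h] with x hx
  have h1 := bracket_mono hσ x
  have h2 := bracket_pos σ x
  have h3 := bracket_pos τ x
  change ‖bracket σ x • g x‖ ≤ C * ‖bracket τ x • f x‖
  rw [norm_smul, norm_smul, Real.norm_of_nonneg h2.le, Real.norm_of_nonneg h3.le]
  calc bracket σ x * ‖g x‖ ≤ bracket τ x * (C * ‖f x‖) := by gcongr
    _ = _ := by ring

lemma mono (hf : MemWLp p τ f) (hσ : σ ≤ τ) : MemWLp p σ f :=
  hf.of_le (C := 1) hσ hf.aestronglyMeasurable (by simp)

lemma congr {g : E n → F} (hf : MemWLp p σ f) (h : f =ᵐ[volume] g) : MemWLp p σ g :=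
  hf.of_le (C := 1) le_rfl (hf.aestronglyMeasurable.congr h)
    (h.mono fun x hx => by rw [hx]; simp)

lemma add {g : E n → F} (hf : MemWLp p σ f) (hg : MemWLp p σ g) :
    MemWLp p σ (fun x => f x + g x) := by
  have h1 := memWLp_iff.1 hf
  have h2 := memWLp_iff.1 hg
  have := h1.add h2
  refine memWLp_iff.2 (this.ae_eq (Filter.Eventually.of_forall fun x => ?_))
  simp only [Pi.add_apply, smul_add]

lemma smul {q r : ENNReal} {A : E n → ℝ} [ENNReal.HolderTriple p q r] (hA : MemWLp p σ A)
    (hf : MemWLp q τ f) : MemWLp r (σ + τ) (fun x => A x • f x) := by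
  have := MemLp.smul (r := r) (memWLp_iff.1 hf) (memWLp_iff.1 hA)
  refine memWLp_iff.2 (this.ae_eq (Filter.Eventually.of_forall fun x => ?_))
  simp only [Pi.smul_apply', smul_smul, bracket_add, smul_eq_mul]
  congr 1; ring

/-- `L^p_s ⊂ L²_σ` for `p > 2` and `σ < s - n (1/2 - 1/p)`. -/
lemma two_of_lt {A : E n → ℝ} (hp : 2 < p) (hA : MemWLp p τ A)
    (h : σ < τ - n * (1 / 2 - (p⁻¹).toReal)) : MemWLp 2 σ A := by
  obtain ⟨hc0, _⟩ := holderTriple_two hp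
  set c : ℝ := 1 / 2 - (p⁻¹).toReal with hc
  -- Hölder against the constant function 1, which lies in this space because `(τ - σ)/c > n`.
  have h1 : MemWLp (ENNReal.ofReal c⁻¹) (σ - τ) (fun _ : E n => (1 : ℝ)) := by
    have : (n : ℝ) < (τ - σ) * c⁻¹ := by
      rw [← div_eq_mul_inv, lt_div_iff₀ hc0]; linarith
    have h3 := memLp_bracket (n := n) (inv_pos.2 hc0) this
    rw [memWLp_iff]
    simpa using h3
  have := hA.smul (r := 2) h1
  simpa using this

/-- Products of `L^p_s` and `L²_{-σ}` lie in `L¹_{-(n-1)/2}` under the weight condition. -/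
lemma smul_one {A : E n → ℝ} (hp : 2 < p) (hA : MemWLp p τ A) (hf : MemWLp 2 (-σ) f)
    (h : σ < τ - 1 / 2 + n * (p⁻¹).toReal) :
    MemWLp 1 (-(((n : ℝ) - 1) / 2)) (fun x => A x • f x) := by
  -- This weight complements `-σ` to `-(n-1)/2`. The inclusion asks for `σ - (n-1)/2 < τ - n/2 +
  -- n/p`, which rearranges to the hypothesis.
  have h1 : MemWLp 2 (σ - ((n : ℝ) - 1) / 2) A := hA.two_of_lt hp (by linarith)
  have := h1.smul (r := 1) hf
  convert this using 1; ring

lemma memLp_restrict (hf : MemWLp p σ f) (R : ℝ) :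
    MemLp f p (volume.restrict (Metric.closedBall 0 R)) := by
  obtain ⟨C, hC⟩ := (isCompact_closedBall (0 : E n) R).exists_bound_of_continuousOn
    (continuous_bracket (-σ)).continuousOn
  refine MemLp.of_le_mul (c := C) ((memWLp_iff.1 hf).restrict _)
    hf.aestronglyMeasurable.restrict ?_
  filter_upwards [ae_restrict_mem measurableSet_closedBall] with x hx
  rw [norm_smul, Real.norm_of_nonneg (bracket_pos _ _).le, ← mul_assoc]
  have h1 := hC x hx
  rw [Real.norm_of_nonneg (bracket_pos _ _).le] at h1
  calc ‖f x‖ = bracket (-σ) x * bracket σ x * ‖f x‖ := by rw [bracket_neg_mul, one_mul]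
    _ ≤ _ := by
      gcongr
      exact (bracket_pos _ _).le

lemma memLp_two_restrict (hf : MemWLp p σ f) (hp : 2 ≤ p) (R : ℝ) :
    MemLp f 2 (volume.restrict (Metric.closedBall 0 R)) := by
  have : IsFiniteMeasure (volume.restrict (Metric.closedBall (0 : E n) R)) :=
    ⟨by simpa using measure_closedBall_lt_top⟩
  exact (hf.memLp_restrict R).mono_exponent hp

end MemWLp

lemma locallyIntegrable_of_memLp_restrict {F : Type*} [NormedAddCommGroup F] {f : E n → F} {p : ENNReal} (hp : 1 ≤ p)
    (hf : ∀ R, MemLp f p (volume.restrict (Metric.closedBall 0 R))) :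
    LocallyIntegrable f volume := by
  rw [locallyIntegrable_iff]
  intro k hk
  obtain ⟨R, hR⟩ := hk.isBounded.subset_closedBall 0
  have : IsFiniteMeasure (volume.restrict (Metric.closedBall (0 : E n) R)) :=
    ⟨by simpa using measure_closedBall_lt_top⟩
  exact IntegrableOn.mono_set ((hf R).integrable hp) hR

end Weights

/-! ### Weighted `L²` inequalities for convolutions. -/

section Convolution

lemma lintegral_mul_sq_le {X : Type*} [MeasurableSpace X] {μ : Measure X} {a b : X → ENNReal}
    (ha : AEMeasurable a μ) (hb : AEMeasurable b μ) :
    (∫⁻ x, a x * b x ∂μ) ^ 2 ≤ (∫⁻ x, a x ^ 2 ∂μ) * ∫⁻ x, b x ^ 2 ∂μ := by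
  have h := ENNReal.lintegral_mul_le_Lp_mul_Lq μ Real.HolderConjugate.two_two ha hb
  have h2 : ∀ t : ENNReal, (t ^ (1 / 2 : ℝ)) ^ 2 = t := fun t => by
    rw [← ENNReal.rpow_natCast, ← ENNReal.rpow_mul]; norm_num
  calc (∫⁻ x, a x * b x ∂μ) ^ 2 ≤ _ := pow_le_pow_left₀ (by positivity) h 2
    _ = _ := by
      rw [mul_pow, h2, h2]
      simp only [ENNReal.rpow_two]

lemma sqrt_mul_self_ennreal (t : ENNReal) : t ^ (1 / 2 : ℝ) * t ^ (1 / 2 : ℝ) = t := by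
  rw [← sq, ← ENNReal.rpow_natCast, ← ENNReal.rpow_mul]; norm_num

lemma sqrt_sq_ennreal (t : ENNReal) : (t ^ (1 / 2 : ℝ)) ^ 2 = t := by
  rw [sq, sqrt_mul_self_ennreal]

variable {n : ℕ} {F : Type*} [NormedAddCommGroup F] [NormedSpace ℝ F]

lemma aemeasurable_sub_kernel {k : E n → ENNReal} (hk : Measurable k) {g : E n → ENNReal}
    (hg : AEMeasurable g volume) :
    AEMeasurable (fun z : E n × E n => k (z.1 - z.2) * g z.2) (volume.prod volume) := by
  refine (hk.comp (measurable_fst.sub measurable_snd)).aemeasurable.mul ?_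
  exact hg.comp_snd

/-- Weighted Young inequality for an integrable kernel along which the weight varies slowly. -/
lemma lintegral_conv_sq_le {k g w : E n → ENNReal} {D : ENNReal} (hk : Measurable k)
    (hg : AEMeasurable g volume) (hw : Measurable w)
    (h : ∀ x y, k (x - y) * w x ≤ D * (k (x - y) * w y)) :
    ∫⁻ x, (∫⁻ y, k (x - y) * g y) ^ 2 * w x ≤ (∫⁻ z, k z) ^ 2 * D * ∫⁻ y, g y ^ 2 * w y := by
  set A := ∫⁻ z, k z with hA
  have h1 : ∀ x, ∫⁻ y, k (x - y) = A := fun x => lintegral_sub_left_eq_self k x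
  have h2 : ∀ y, ∫⁻ x, k (x - y) = A := fun y => lintegral_sub_right_eq_self k y
  have hkx : ∀ x, Measurable fun y => k (x - y) := fun x => hk.comp (measurable_const.sub measurable_id)
  have hky : ∀ y, Measurable fun x => k (x - y) := fun y => hk.comp (measurable_id.sub measurable_const)
  -- Schur's argument: Cauchy–Schwarz after writing `k = k^{1/2} k^{1/2}`. The hypothesis on `w`
  -- then moves the weight from `x` to `y`, and Tonelli leaves a second factor `∫ k`.
  have hcs : ∀ x, (∫⁻ y, k (x - y) * g y) ^ 2 ≤ A * ∫⁻ y, k (x - y) * g y ^ 2 := by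
    intro x
    have := lintegral_mul_sq_le (μ := volume) (a := fun y => k (x - y) ^ (1 / 2 : ℝ))
      (b := fun y => k (x - y) ^ (1 / 2 : ℝ) * g y) ((hkx x).pow_const _).aemeasurable
      (((hkx x).pow_const _).aemeasurable.mul hg)
    simpa only [← mul_assoc, mul_pow, sqrt_mul_self_ennreal, sqrt_sq_ennreal, h1] using this
  calc ∫⁻ x, (∫⁻ y, k (x - y) * g y) ^ 2 * w x
      ≤ ∫⁻ x, A * ∫⁻ y, D * (k (x - y) * (g y ^ 2 * w y)) := by
        refine lintegral_mono fun x => ?_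
        calc _ ≤ (A * ∫⁻ y, k (x - y) * g y ^ 2) * w x := by gcongr; exact hcs x
          _ = A * ∫⁻ y, k (x - y) * g y ^ 2 * w x := by
            rw [lintegral_mul_const'' _ ((hkx x).aemeasurable.fun_mul (hg.pow_const 2)), mul_assoc]
          _ ≤ _ := by
            refine mul_le_mul_right (lintegral_mono fun y => ?_) A
            calc k (x - y) * g y ^ 2 * w x = k (x - y) * w x * g y ^ 2 := by ring
              _ ≤ D * (k (x - y) * w y) * g y ^ 2 := by gcongr ?_ * _; exact h x y
              _ = _ := by ring
    _ = A * D * ∫⁻ x, ∫⁻ y, k (x - y) * (g y ^ 2 * w y) := by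
        have hm : AEMeasurable (fun x => ∫⁻ y, k (x - y) * (g y ^ 2 * w y)) volume :=
          (aemeasurable_sub_kernel hk ((hg.pow_const 2).mul hw.aemeasurable)).lintegral_prod_right'
        have : ∀ x, ∫⁻ y, D * (k (x - y) * (g y ^ 2 * w y)) = D * ∫⁻ y, k (x - y) * (g y ^ 2 * w y) :=
          fun x => lintegral_const_mul'' _
            ((hkx x).aemeasurable.mul ((hg.pow_const 2).mul hw.aemeasurable))
        simp_rw [this, ← mul_assoc]
        simp_rw [← mul_assoc] at hm
        rw [lintegral_const_mul'' _ hm]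
    _ = A * D * ∫⁻ y, ∫⁻ x, k (x - y) * (g y ^ 2 * w y) := by
        congr 1
        exact lintegral_lintegral_swap
          (aemeasurable_sub_kernel hk ((hg.pow_const 2).mul hw.aemeasurable))
    _ = A * D * ∫⁻ y, A * (g y ^ 2 * w y) := by
        congr 2 with y
        rw [lintegral_mul_const'' _ (hky y).aemeasurable, h2]
    _ = _ := by
        rw [lintegral_const_mul'' _ ((hg.pow_const 2).fun_mul hw.aemeasurable)]
        ring

/-- Minkowski-type bound for a kernel whose weighted square integral is controlled by a weight
in the second variable. -/
lemma lintegral_conv_sq_le_of_kernel {k g w m m' : E n → ENNReal} {D : ENNReal} (hk : Measurable k)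
    (hg : AEMeasurable g volume) (hw : Measurable w) (hm : Measurable m) (hm' : Measurable m')
    (hmm : ∀ y, m' y * m y = 1)
    (h : ∀ y, ∫⁻ x, k (x - y) ^ 2 * w x ≤ D * m' y ^ 2) :
    ∫⁻ x, (∫⁻ y, k (x - y) * g y) ^ 2 * w x ≤ D * (∫⁻ y, m' y * g y) ^ 2 := by
  have hkx : ∀ x, Measurable fun y => k (x - y) := fun x => hk.comp (measurable_const.sub measurable_id)
  have hky : ∀ y, Measurable fun x => k (x - y) := fun y => hk.comp (measurable_id.sub measurable_const)
  set N := ∫⁻ y, m' y * g y with hN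
  -- Cauchy–Schwarz with the splitting `k g = (m' g)^{1/2} · k (m g)^{1/2}`, valid as `m' m = 1`.
  -- After Tonelli the kernel hypothesis contributes `m'²`, which turns `m g` back into `m' g`.
  have hcs : ∀ x, (∫⁻ y, k (x - y) * g y) ^ 2 ≤ N * ∫⁻ y, k (x - y) ^ 2 * (m y * g y) := by
    intro x
    have := lintegral_mul_sq_le (μ := volume) (a := fun y => (m' y * g y) ^ (1 / 2 : ℝ))
      (b := fun y => k (x - y) * (m y * g y) ^ (1 / 2 : ℝ)) ((hm'.aemeasurable.mul hg).pow_const _)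
      ((hkx x).aemeasurable.mul ((hm.aemeasurable.mul hg).pow_const _))
    have h3 : ∀ y, (m' y * g y) ^ (1 / 2 : ℝ) * (k (x - y) * (m y * g y) ^ (1 / 2 : ℝ))
        = k (x - y) * g y := by
      intro y
      have h4 : (m' y * g y) ^ (1 / 2 : ℝ) * (m y * g y) ^ (1 / 2 : ℝ) = g y := by
        rw [← ENNReal.mul_rpow_of_nonneg _ _ (by norm_num)]
        rw [show m' y * g y * (m y * g y) = (m' y * m y) * (g y * g y) by ring, hmm, one_mul,
          ENNReal.mul_rpow_of_nonneg _ _ (by norm_num), sqrt_mul_self_ennreal]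
      calc _ = k (x - y) * ((m' y * g y) ^ (1 / 2 : ℝ) * (m y * g y) ^ (1 / 2 : ℝ)) := by ring
        _ = _ := by rw [h4]
    simpa only [h3, mul_pow, sqrt_sq_ennreal] using this
  have hmg : AEMeasurable (fun y => m y * g y) volume := hm.aemeasurable.mul hg
  have hprod : AEMeasurable (fun z : E n × E n => k (z.1 - z.2) ^ 2 * w z.1 * (m z.2 * g z.2))
      (volume.prod volume) := by
    refine AEMeasurable.mul ?_ hmg.comp_snd
    exact (((hk.comp (measurable_fst.sub measurable_snd)).pow_const 2).mul
      (hw.comp measurable_fst)).aemeasurable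
  calc ∫⁻ x, (∫⁻ y, k (x - y) * g y) ^ 2 * w x
      ≤ ∫⁻ x, N * ∫⁻ y, k (x - y) ^ 2 * w x * (m y * g y) := by
        refine lintegral_mono fun x => ?_
        calc _ ≤ (N * ∫⁻ y, k (x - y) ^ 2 * (m y * g y)) * w x := by gcongr; exact hcs x
          _ = N * ∫⁻ y, k (x - y) ^ 2 * (m y * g y) * w x := by
            rw [lintegral_mul_const'' _ (((hkx x).pow_const 2).aemeasurable.fun_mul hmg), mul_assoc]
          _ = _ := by
            congr 2 with y
            ring
    _ = N * ∫⁻ x, ∫⁻ y, k (x - y) ^ 2 * w x * (m y * g y) := by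
        exact lintegral_const_mul'' _ hprod.lintegral_prod_right'
    _ = N * ∫⁻ y, ∫⁻ x, k (x - y) ^ 2 * w x * (m y * g y) := by
        congr 1
        exact lintegral_lintegral_swap hprod
    _ ≤ N * ∫⁻ y, D * (m' y * g y) := by
        gcongr with y
        rw [lintegral_mul_const'' _ (((hky y).pow_const 2).fun_mul hw).aemeasurable]
        calc _ ≤ D * m' y ^ 2 * (m y * g y) := by gcongr; exact h y
          _ = D * (m' y * g y) * (m' y * m y) := by ring
          _ = _ := by rw [hmm, mul_one]
    _ = _ := by
        rw [lintegral_const_mul'' _ (hm'.aemeasurable.fun_mul hg)]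
        ring

/-- Both weights decrease with the norm, so moving the factor at the point of larger norm to the
other point only increases the product. -/
lemma bracket_mul_bracket_le {a b : ℝ} (ha : 0 ≤ a) (hb : 0 ≤ b) (x y : E n) :
    bracket (-a) x * bracket (-b) y ≤ bracket (-(a + b)) x + bracket (-(a + b)) y := by
  have hx := one_add_norm_sq_pos x
  have hy := one_add_norm_sq_pos y
  have e1 := bracket_add (-a) (-b) x
  have e2 := bracket_add (-a) (-b) y
  rw [← neg_add] at e1 e2
  have p1 := bracket_pos (-a) x
  have p2 := bracket_pos (-b) x
  have p3 := bracket_pos (-a) y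
  have p4 := bracket_pos (-b) y
  rcases le_total (1 + ‖x‖ ^ 2) (1 + ‖y‖ ^ 2) with h | h
  · have : bracket (-b) y ≤ bracket (-b) x :=
      Real.rpow_le_rpow_of_nonpos hx h (by linarith)
    rw [e1, e2]
    nlinarith [mul_pos p3 p4]
  · have : bracket (-a) x ≤ bracket (-a) y :=
      Real.rpow_le_rpow_of_nonpos hy h (by linarith)
    rw [e1, e2]
    nlinarith [mul_pos p1 p2]

lemma measurable_ofReal_bracket (σ : ℝ) :
    Measurable fun x : E n => ENNReal.ofReal (bracket σ x) :=
  (continuous_bracket σ).measurable.ennreal_ofReal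

/-- Insert `⟨y⟩^{-(n-1)} ⟨y⟩^{n-1}` and split the growing factor as a multiple of `⟨x⟩^{n-1} +
⟨x-y⟩^{n-1}`. The second summand cancels the kernel and leaves `⟨x⟩^{-s}`. The first leaves
`⟨x⟩^{-(s-(n-1))} ⟨x-y⟩^{-(n-1)}`, at most `⟨x⟩^{-s} + ⟨x-y⟩^{-s}`. All of these are integrable,
uniformly in `y`. -/
lemma exists_lintegral_bracket_le (hn : 1 ≤ n) {s : ℝ} (hs : n < s) :
    ∃ D : ENNReal, D ≠ ⊤ ∧ ∀ y : E n,
      ∫⁻ x : E n, ENNReal.ofReal (bracket (-(((n : ℝ) - 1) / 2)) (x - y)) ^ 2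
        * ENNReal.ofReal (bracket (-s) x)
      ≤ D * ENNReal.ofReal (bracket (-(((n : ℝ) - 1) / 2)) y) ^ 2 := by
  have hn1 : (0 : ℝ) ≤ n - 1 := by
    have : (1 : ℝ) ≤ n := by exact_mod_cast hn
    linarith
  set I : ENNReal := ∫⁻ x : E n, ENNReal.ofReal (bracket (-s) x) with hI
  have hIfin : I ≠ ⊤ := by
    have := (integrable_bracket hs).lintegral_lt_top
    exact this.ne
  set c : ℝ := 4 ^ (((n : ℝ) - 1) / 2) with hc
  have hc0 : 0 ≤ c := by positivity
  refine ⟨ENNReal.ofReal c * (2 * I + I), by finiteness, fun y => ?_⟩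
  have hsq : ∀ z : E n, bracket (-(((n : ℝ) - 1) / 2)) z ^ 2 = bracket (-((n : ℝ) - 1)) z := by
    intro z
    rw [sq, ← bracket_add]; congr 1; ring
  have key : ∀ x : E n, bracket (-(((n : ℝ) - 1) / 2)) (x - y) ^ 2 * bracket (-s) x
      ≤ c * (2 * bracket (-s) x + bracket (-s) (x - y)) * bracket (-(((n : ℝ) - 1) / 2)) y ^ 2 := by
    intro x
    rw [hsq, hsq]
    have h1 := bracket_le_add hn1 x y
    have h2 := bracket_neg_mul ((n : ℝ) - 1) y
    have h3 := bracket_neg_mul ((n : ℝ) - 1) (x - y)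
    have h4 := bracket_mul_bracket_le (a := s - (n - 1)) (b := n - 1) (by linarith) hn1 x (x - y)
    have h5 : s - ((n : ℝ) - 1) + (n - 1) = s := by ring
    rw [h5] at h4
    have h6 : bracket (-(s - ((n : ℝ) - 1))) x = bracket (-s) x * bracket ((n : ℝ) - 1) x := by
      rw [← bracket_add]; congr 1; ring
    rw [h6] at h4
    have p1 := bracket_pos (-s) x
    have p2 := bracket_pos (-((n : ℝ) - 1)) (x - y)
    have p3 := bracket_pos (-((n : ℝ) - 1)) y
    calc bracket (-((n : ℝ) - 1)) (x - y) * bracket (-s) x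
        = bracket (-((n : ℝ) - 1)) (x - y) * bracket (-s) x *
          (bracket (-((n : ℝ) - 1)) y * bracket ((n : ℝ) - 1) y) := by rw [h2, mul_one]
      _ ≤ bracket (-((n : ℝ) - 1)) (x - y) * bracket (-s) x *
          (bracket (-((n : ℝ) - 1)) y * (c * (bracket ((n : ℝ) - 1) x
            + bracket ((n : ℝ) - 1) (x - y)))) := by gcongr
      _ = c * (bracket (-s) x * bracket ((n : ℝ) - 1) x * bracket (-((n : ℝ) - 1)) (x - y)
            + bracket (-s) x * (bracket (-((n : ℝ) - 1)) (x - y) * bracket ((n : ℝ) - 1) (x - y)))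
            * bracket (-((n : ℝ) - 1)) y := by ring
      _ ≤ c * ((bracket (-s) x + bracket (-s) (x - y)) + bracket (-s) x * 1)
            * bracket (-((n : ℝ) - 1)) y := by rw [h3]; gcongr
      _ = _ := by ring
  have hsub : ∫⁻ x : E n, ENNReal.ofReal (bracket (-s) (x - y)) = I :=
    lintegral_sub_right_eq_self (fun z => ENNReal.ofReal (bracket (-s) z)) y
  have hm := measurable_ofReal_bracket (n := n) (-s)
  have hms : Measurable fun x : E n => ENNReal.ofReal (bracket (-s) (x - y)) :=
    hm.comp (measurable_id.sub measurable_const)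
  calc _ ≤ ∫⁻ x : E n, ENNReal.ofReal c * (2 * ENNReal.ofReal (bracket (-s) x)
          + ENNReal.ofReal (bracket (-s) (x - y)))
          * ENNReal.ofReal (bracket (-(((n : ℝ) - 1) / 2)) y) ^ 2 := by
        refine lintegral_mono fun x => ?_
        have p1 := (bracket_pos (-s) x).le
        have p2 := (bracket_pos (-s) (x - y)).le
        have p3 := (bracket_pos (-(((n : ℝ) - 1) / 2)) (x - y)).le
        have p4 := (bracket_pos (-(((n : ℝ) - 1) / 2)) y).le
        have := ENNReal.ofReal_le_ofReal (key x)
        rw [ENNReal.ofReal_mul (by positivity), ENNReal.ofReal_mul (by positivity),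
          ENNReal.ofReal_mul hc0, ENNReal.ofReal_add (by positivity) p2,
          ENNReal.ofReal_mul (by norm_num), ENNReal.ofReal_pow p3, ENNReal.ofReal_pow p4] at this
        simpa using this
    _ = _ := by
        rw [lintegral_mul_const _ (by fun_prop), lintegral_const_mul _ (by fun_prop),
          lintegral_add_left (by fun_prop), lintegral_const_mul _ hm, hsub]

/-- In polar coordinates the radial power is `(n-1) - (n+1)/2 = (n-3)/2`, which exceeds `-1` because
`n > 1`. -/
lemma lintegral_near_kernel_ne_top (hn : 2 ≤ n) :
    ∫⁻ z : E n, (Metric.closedBall (0 : E n) 1).indicator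
      (fun z => ENNReal.ofReal (‖z‖ ^ (-(((n : ℝ) - 1) / 2) - 1))) z ≠ ⊤ := by
  have : Nontrivial (E n) := by
    have : Nonempty (Fin n) := ⟨⟨0, by omega⟩⟩
    infer_instance
  set a : ℝ := -(((n : ℝ) - 1) / 2) - 1 with ha
  have h := (integrable_fun_norm_addHaar (E := E n) (volume : Measure (E n))
    (f := (Set.Iic (1 : ℝ)).indicator (fun r => r ^ a))).2 ?_
  · have h2 := h.lintegral_lt_top
    refine ne_of_lt (lt_of_le_of_lt (lintegral_mono fun z => ?_) h2)
    by_cases hz : ‖z‖ ≤ 1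
    · rw [Set.indicator_of_mem (by simpa using hz), Set.indicator_of_mem (by simpa using hz)]
    · rw [Set.indicator_of_notMem (by simpa using hz)]
      simp
  · have hn' : (2 : ℝ) ≤ n := by exact_mod_cast hn
    have h1 : IntegrableOn (fun r : ℝ => r ^ ((n : ℝ) - 1 + a)) (Set.Ioc 0 1) := by
      rw [← intervalIntegrable_iff_integrableOn_Ioc_of_le zero_le_one]
      exact intervalIntegral.intervalIntegrable_rpow' (by rw [ha]; linarith)
    have h2 : IntegrableOn ((Set.Iic (1 : ℝ)).indicator (fun r : ℝ => r ^ ((n : ℝ) - 1 + a)))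
        (Set.Ioi 0) := by
      rw [IntegrableOn, integrable_indicator_iff measurableSet_Iic, IntegrableOn,
        Measure.restrict_restrict measurableSet_Iic, Set.inter_comm, Set.Ioi_inter_Iic]
      exact h1
    refine h2.congr_fun ?_ measurableSet_Ioi
    intro r hr
    have hr : 0 < r := hr
    by_cases h : r ≤ 1
    · simp only [Set.indicator_of_mem (show r ∈ Set.Iic 1 from h), smul_eq_mul, finrank_euclideanSpace,
        Fintype.card_fin]
      rw [Real.rpow_add hr, ← Real.rpow_natCast, Nat.cast_sub (by omega)]
      simp
    · simp [h]

end Convolution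

/-! ### Convolution with kernels of the size of the Green function. -/

section KernelConvolution

variable {n : ℕ} {F : Type*} [NormedAddCommGroup F] [NormedSpace ℝ F]

lemma memWLp_two_iff {σ : ℝ} {f : E n → F} (hf : AEStronglyMeasurable f volume) :
    MemWLp 2 (-σ) f ↔ ∫⁻ x, ‖f x‖ₑ ^ 2 * ENNReal.ofReal (bracket (-(2 * σ)) x) < ⊤ := by
  have h : ∀ x, ‖f x‖ₑ ^ 2 * ENNReal.ofReal (bracket (-(2 * σ)) x)
      = ‖bracket (-σ) x • f x‖ₑ ^ (2 : ENNReal).toReal := by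
    intro x
    have : bracket (-(2 * σ)) x = bracket (-σ) x ^ 2 := by
      rw [sq, ← bracket_add]; congr 1; ring
    rw [enorm_smul, this, ENNReal.ofReal_pow (bracket_pos _ _).le,
      Real.enorm_of_nonneg (bracket_pos _ _).le]
    simp [mul_pow, mul_comm]
  simp_rw [h]
  rw [memWLp_iff, MemLp, ← eLpNorm_lt_top_iff_lintegral_rpow_enorm_lt_top (by simp) (by simp)]
  exact and_iff_right ((continuous_bracket _).aestronglyMeasurable.smul hf)

lemma MemWLp.lintegral_lt_top {σ : ℝ} {f : E n → F} (hf : MemWLp 1 σ f) :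
    ∫⁻ x, ENNReal.ofReal (bracket σ x) * ‖f x‖ₑ < ⊤ := by
  have h1 := memWLp_iff.1 hf
  have h := (memLp_one_iff_integrable.1 h1).2
  rw [HasFiniteIntegral] at h
  refine lt_of_eq_of_lt (lintegral_congr fun x => ?_) h
  rw [enorm_smul, Real.enorm_of_nonneg (bracket_pos _ _).le]

lemma add_sq_le_two_mul_ennreal (a b : ENNReal) : (a + b) ^ 2 ≤ 2 * (a ^ 2 + b ^ 2) := by
  have := ENNReal.rpow_add_le_mul_rpow_add_rpow a b (p := 2) (by norm_num)
  norm_num at this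
  simpa using this

/-- The more singular power dominates in the unit ball and the slower decay dominates outside, where
`1 + r² ≤ 2r²` converts `r^{-α}` into the bracket. -/
lemma kernel_le_near_add_far {α r : ℝ} (hα : 0 < α) (z : E n) (hz : ‖z‖ = r) :
    r ^ (-α) + r ^ (-α - 1) ≤ 2 * (Metric.closedBall (0 : E n) 1).indicator
      (fun z => ‖z‖ ^ (-α - 1)) z + 2 * 2 ^ (α / 2) * bracket (-α) z := by
  have hb := bracket_pos (-α) z
  rcases (hz ▸ norm_nonneg z : 0 ≤ r).eq_or_lt with h0 | h0
  · rw [← h0, Real.zero_rpow (by linarith), Real.zero_rpow (by linarith)]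
    have : 0 ≤ (Metric.closedBall (0 : E n) 1).indicator (fun z => ‖z‖ ^ (-α - 1)) z :=
      Set.indicator_nonneg (fun z _ => by positivity) z
    rw [add_zero]
    positivity
  rcases le_or_gt r 1 with h | h
  · rw [Set.indicator_of_mem (by simpa [hz] using h), hz]
    have h1 : r ^ (-α) ≤ r ^ (-α - 1) :=
      Real.rpow_le_rpow_of_exponent_ge h0 h (by linarith)
    have : 0 < 2 * 2 ^ (α / 2) * bracket (-α) z := by positivity
    linarith
  · rw [Set.indicator_of_notMem (by simpa [hz] using h)]
    have h1 : r ^ (-α - 1) ≤ r ^ (-α) :=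
      Real.rpow_le_rpow_of_exponent_le h.le (by linarith)
    have h2 : r ^ (-α) ≤ 2 ^ (α / 2) * bracket (-α) z := by
      have h3 : (2 * r ^ 2) ^ (-α / 2) ≤ bracket (-α) z := by
        unfold bracket
        rw [hz]
        refine Real.rpow_le_rpow_of_nonpos (by positivity) ?_ (by linarith)
        nlinarith
      have h4 : (2 * r ^ 2) ^ (-α / 2) = 2 ^ (-(α / 2)) * r ^ (-α) := by
        rw [Real.mul_rpow (by norm_num) (by positivity), ← Real.rpow_natCast r 2,
          ← Real.rpow_mul h0.le]
        congr 2
        · ring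
        · push_cast; ring
      have h5 : (2 : ℝ) ^ (α / 2) * 2 ^ (-(α / 2)) = 1 := by
        rw [← Real.rpow_add (by norm_num), add_neg_cancel, Real.rpow_zero]
      calc r ^ (-α) = 2 ^ (α / 2) * (2 ^ (-(α / 2)) * r ^ (-α)) := by rw [← mul_assoc, h5, one_mul]
        _ ≤ _ := by rw [← h4]; gcongr
    linarith

/-- Convolution with a kernel of the size of the outgoing Green function maps
`L¹_{-(n-1)/2} ∩ L²_{-σ}` to `L²_{-σ}` for `σ > n/2`. -/
lemma lintegral_kernel_conv_lt_top (hn : 2 ≤ n) {σ C : ℝ} (hσ : (n : ℝ) / 2 < σ) {Γ : E n → ℂ}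
    (hΓb : ∀ z, ‖Γ z‖ ≤ C * (‖z‖ ^ (-(((n : ℝ) - 1) / 2)) + ‖z‖ ^ (-(((n : ℝ) - 1) / 2) - 1)))
    {g : E n → ℂ} (hg1 : MemWLp 1 (-(((n : ℝ) - 1) / 2)) g) (hg2 : MemWLp 2 (-σ) g) :
    ∫⁻ x, (∫⁻ y, ‖Γ (x - y)‖ₑ * ‖g y‖ₑ) ^ 2 * ENNReal.ofReal (bracket (-(2 * σ)) x) < ⊤ := by
  have hn' : (2 : ℝ) ≤ n := by exact_mod_cast hn
  set α : ℝ := ((n : ℝ) - 1) / 2 with hα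
  have hα0 : 0 < α := by rw [hα]; linarith
  set k₁ : E n → ENNReal := (Metric.closedBall (0 : E n) 1).indicator
      (fun z => ENNReal.ofReal (‖z‖ ^ (-α - 1))) with hk₁
  set k₂ : E n → ENNReal := fun z => ENNReal.ofReal (bracket (-α) z) with hk₂
  set w : E n → ENNReal := fun x => ENNReal.ofReal (bracket (-(2 * σ)) x) with hw
  have hgm : AEMeasurable (fun y => ‖g y‖ₑ) volume := hg2.aestronglyMeasurable.enorm
  have mk₁ : Measurable k₁ :=
    Measurable.indicator (by fun_prop) measurableSet_closedBall
  have mk₂ : Measurable k₂ := measurable_ofReal_bracket _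
  have mw : Measurable w := measurable_ofReal_bracket _
  -- The near kernel is integrable and the weight is comparable at points of distance at most one,
  -- so Young's inequality applies. Only the `L²_{-σ}` bound on `g` is used.
  have hnear : ∫⁻ x, (∫⁻ y, k₁ (x - y) * ‖g y‖ₑ) ^ 2 * w x < ⊤ := by
    refine lt_of_le_of_lt (lintegral_conv_sq_le (D := ENNReal.ofReal (3 ^ (2 * σ / 2))) mk₁ hgm mw ?_) ?_
    · intro x y
      by_cases h : ‖x - y‖ ≤ 1
      · have := ENNReal.ofReal_le_ofReal
          (bracket_neg_le_of_norm_sub_le_one (σ := 2 * σ) (by linarith) h)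
        rw [ENNReal.ofReal_mul (by positivity)] at this
        calc k₁ (x - y) * w x ≤ k₁ (x - y) * (ENNReal.ofReal (3 ^ (2 * σ / 2)) * w y) := by gcongr
          _ = _ := by ring
      · have : k₁ (x - y) = 0 := Set.indicator_of_notMem (by simpa using h) _
        simp [this]
    · have h1 := (memWLp_two_iff hg2.aestronglyMeasurable).1 hg2
      have h2 : ∫⁻ z, k₁ z ≠ ⊤ := lintegral_near_kernel_ne_top hn
      exact ENNReal.mul_lt_top (by finiteness) h1
  -- The far kernel is not integrable. Here the `L¹_{-(n-1)/2}` bound on `g` enters, together with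
  -- `2σ > n`.
  have hfar : ∫⁻ x, (∫⁻ y, k₂ (x - y) * ‖g y‖ₑ) ^ 2 * w x < ⊤ := by
    obtain ⟨D, hD, hD'⟩ := exists_lintegral_bracket_le (n := n) (by omega) (s := 2 * σ) (by linarith)
    refine lt_of_le_of_lt (lintegral_conv_sq_le_of_kernel (D := D) (m' := k₂)
      (m := fun y => ENNReal.ofReal (bracket α y)) mk₂ hgm mw
      (measurable_ofReal_bracket _) mk₂ ?_ hD') ?_
    · intro y
      rw [hk₂, ← ENNReal.ofReal_mul (bracket_pos _ _).le, bracket_neg_mul, ENNReal.ofReal_one]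
    · have := hg1.lintegral_lt_top
      exact ENNReal.mul_lt_top hD.lt_top (ENNReal.pow_lt_top this)
  set a : ENNReal := ENNReal.ofReal (|C| * 2) with ha
  set b : ENNReal := ENNReal.ofReal (|C| * (2 * 2 ^ (α / 2))) with hb
  have hle : ∀ z, ‖Γ z‖ₑ ≤ a * k₁ z + b * k₂ z := by
    intro z
    have h1 : ‖Γ z‖ ≤ |C| * 2 * (Metric.closedBall (0 : E n) 1).indicator (fun z => ‖z‖ ^ (-α - 1)) z
        + |C| * (2 * 2 ^ (α / 2)) * bracket (-α) z := by
      have h2 := kernel_le_near_add_far hα0 z rfl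
      have h3 : 0 ≤ ‖z‖ ^ (-α) + ‖z‖ ^ (-α - 1) := by positivity
      calc _ ≤ C * _ := hΓb z
        _ ≤ |C| * (‖z‖ ^ (-α) + ‖z‖ ^ (-α - 1)) := by gcongr; exact le_abs_self C
        _ ≤ |C| * _ := mul_le_mul_of_nonneg_left h2 (abs_nonneg C)
        _ = _ := by ring
    have h4 : 0 ≤ (Metric.closedBall (0 : E n) 1).indicator (fun z => ‖z‖ ^ (-α - 1)) z :=
      Set.indicator_nonneg (fun z _ => by positivity) z
    have h5 := bracket_pos (-α) z
    have h6 : k₁ z = ENNReal.ofReal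
        ((Metric.closedBall (0 : E n) 1).indicator (fun z => ‖z‖ ^ (-α - 1)) z) := by
      rw [hk₁]
      by_cases h : z ∈ Metric.closedBall (0 : E n) 1
      · simp only [Set.indicator_of_mem h]
      · simp only [Set.indicator_of_notMem h, ENNReal.ofReal_zero]
    rw [← ofReal_norm, h6, hk₂, ha, hb, ← ENNReal.ofReal_mul (by positivity),
      ← ENNReal.ofReal_mul (by positivity), ← ENNReal.ofReal_add (by positivity) (by positivity)]
    exact ENNReal.ofReal_le_ofReal h1
  have hm : ∀ {k : E n → ENNReal}, Measurable k →
      AEMeasurable (fun x => (∫⁻ y, k (x - y) * ‖g y‖ₑ) ^ 2 * w x) volume := fun hk =>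
    ((aemeasurable_sub_kernel hk hgm).lintegral_prod_right'.pow_const 2).mul mw.aemeasurable
  have hmx : ∀ {k : E n → ENNReal}, Measurable k → ∀ x,
      AEMeasurable (fun y => k (x - y) * ‖g y‖ₑ) volume := fun hk x =>
    (hk.comp (measurable_const.sub measurable_id)).aemeasurable.mul hgm
  have hpt : ∀ x, (∫⁻ y, ‖Γ (x - y)‖ₑ * ‖g y‖ₑ) ^ 2 * w x
      ≤ 2 * a ^ 2 * ((∫⁻ y, k₁ (x - y) * ‖g y‖ₑ) ^ 2 * w x)
        + 2 * b ^ 2 * ((∫⁻ y, k₂ (x - y) * ‖g y‖ₑ) ^ 2 * w x) := by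
    intro x
    calc _ ≤ (∫⁻ y, (a * (k₁ (x - y) * ‖g y‖ₑ) + b * (k₂ (x - y) * ‖g y‖ₑ))) ^ 2 * w x := by
          gcongr with y
          calc _ ≤ (a * k₁ (x - y) + b * k₂ (x - y)) * ‖g y‖ₑ := by gcongr; exact hle _
            _ = _ := by ring
      _ = (a * (∫⁻ y, k₁ (x - y) * ‖g y‖ₑ) + b * (∫⁻ y, k₂ (x - y) * ‖g y‖ₑ)) ^ 2 * w x := by
          rw [lintegral_add_left' ((hmx mk₁ x).const_mul _), lintegral_const_mul'' _ (hmx mk₁ x),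
            lintegral_const_mul'' _ (hmx mk₂ x)]
      _ ≤ _ := by
          refine (mul_le_mul_left (add_sq_le_two_mul_ennreal _ _) _).trans (le_of_eq ?_)
          ring
  refine lt_of_le_of_lt (lintegral_mono hpt) ?_
  rw [lintegral_add_left' ((hm mk₁).const_mul _), lintegral_const_mul'' _ (hm mk₁),
    lintegral_const_mul'' _ (hm mk₂)]
  exact ENNReal.add_lt_top.2 ⟨ENNReal.mul_lt_top (by finiteness) hnear,
    ENNReal.mul_lt_top (by finiteness) hfar⟩

/-- A measurable kernel on `ℝⁿ` of the size of the outgoing Green function. -/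
structure IsGreenKernel (C : ℝ) (Γ : E n → ℂ) : Prop where
  measurable : Measurable Γ
  norm_le : ∀ z, ‖Γ z‖ ≤ C * (‖z‖ ^ (-(((n : ℝ) - 1) / 2)) + ‖z‖ ^ (-(((n : ℝ) - 1) / 2) - 1))

namespace IsGreenKernel

variable {σ C : ℝ} {Γ g : E n → ℂ}

lemma aestronglyMeasurable_prod (hΓ : Measurable Γ) (hg : AEStronglyMeasurable g volume) :
    AEStronglyMeasurable (fun z : E n × E n => Γ (z.1 - z.2) * g z.2) (volume.prod volume) :=
  (hΓ.comp (measurable_fst.sub measurable_snd)).aestronglyMeasurable.mul hg.comp_snd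

lemma ae_lintegral_lt_top (hΓ : IsGreenKernel C Γ) (hn : 2 ≤ n) (hσ : (n : ℝ) / 2 < σ)
    (hg1 : MemWLp 1 (-(((n : ℝ) - 1) / 2)) g) (hg2 : MemWLp 2 (-σ) g) :
    ∀ᵐ x, ∫⁻ y, ‖Γ (x - y)‖ₑ * ‖g y‖ₑ < ⊤ := by
  have h := lintegral_kernel_conv_lt_top hn hσ hΓ.norm_le hg1 hg2
  have hgm : AEMeasurable (fun y => ‖g y‖ₑ) volume := hg2.aestronglyMeasurable.enorm
  have hm : AEMeasurable (fun x => (∫⁻ y, ‖Γ (x - y)‖ₑ * ‖g y‖ₑ) ^ 2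
      * ENNReal.ofReal (bracket (-(2 * σ)) x)) volume :=
    ((aemeasurable_sub_kernel hΓ.measurable.enorm hgm).lintegral_prod_right'.pow_const 2).mul
      (measurable_ofReal_bracket _).aemeasurable
  filter_upwards [ae_lt_top' hm h.ne] with x hx
  by_contra hcon
  rw [not_lt, top_le_iff] at hcon
  rw [hcon] at hx
  have : ENNReal.ofReal (bracket (-(2 * σ)) x) ≠ 0 := by
    simpa using bracket_pos (-(2 * σ)) x
  simp [ENNReal.top_mul this] at hx

lemma ae_integrable (hΓ : IsGreenKernel C Γ) (hn : 2 ≤ n) (hσ : (n : ℝ) / 2 < σ)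
    (hg1 : MemWLp 1 (-(((n : ℝ) - 1) / 2)) g) (hg2 : MemWLp 2 (-σ) g) :
    ∀ᵐ x, Integrable (fun y => Γ (x - y) * g y) volume := by
  filter_upwards [hΓ.ae_lintegral_lt_top hn hσ hg1 hg2] with x hx
  refine ⟨(hΓ.measurable.comp (measurable_const.sub measurable_id)).aestronglyMeasurable.mul
    hg2.aestronglyMeasurable, ?_⟩
  simpa [HasFiniteIntegral, enorm_mul] using hx

lemma memWLp_integral (hΓ : IsGreenKernel C Γ) (hn : 2 ≤ n) (hσ : (n : ℝ) / 2 < σ)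
    (hg1 : MemWLp 1 (-(((n : ℝ) - 1) / 2)) g) (hg2 : MemWLp 2 (-σ) g) :
    MemWLp 2 (-σ) (fun x => ∫ y, Γ (x - y) * g y) := by
  rw [memWLp_two_iff
    (aestronglyMeasurable_prod hΓ.measurable hg2.aestronglyMeasurable).integral_prod_right']
  refine lt_of_le_of_lt (lintegral_mono fun x => ?_)
    (lintegral_kernel_conv_lt_top hn hσ hΓ.norm_le hg1 hg2)
  gcongr
  refine (enorm_integral_le_lintegral_enorm _).trans (le_of_eq ?_)
  simp [enorm_mul]

/-- Justifies Fubini against test functions. The convolution of absolute values is in `L²_{-σ}`,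
hence locally integrable, hence integrable against a continuous compactly supported factor. -/
lemma integrable_prod (hΓ : IsGreenKernel C Γ) (hn : 2 ≤ n) (hσ : (n : ℝ) / 2 < σ)
    (hg1 : MemWLp 1 (-(((n : ℝ) - 1) / 2)) g) (hg2 : MemWLp 2 (-σ) g)
    {φ : E n → ℝ} (hφ : Continuous φ) (hφc : HasCompactSupport φ) :
    Integrable (fun z : E n × E n => φ z.1 • (Γ (z.1 - z.2) * g z.2)) (volume.prod volume) := by
  have hm : AEStronglyMeasurable (fun z : E n × E n => φ z.1 • (Γ (z.1 - z.2) * g z.2))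
      (volume.prod volume) :=
    (hφ.comp continuous_fst).aestronglyMeasurable.smul
      (aestronglyMeasurable_prod hΓ.measurable hg2.aestronglyMeasurable)
  have hgm : AEMeasurable (fun y => ‖g y‖ₑ) volume := hg2.aestronglyMeasurable.enorm
  have hIm : AEMeasurable (fun x => ∫⁻ y, ‖Γ (x - y)‖ₑ * ‖g y‖ₑ) volume :=
    (aemeasurable_sub_kernel hΓ.measurable.enorm hgm).lintegral_prod_right'
  have hI : MemWLp 2 (-σ) (fun x => (∫⁻ y, ‖Γ (x - y)‖ₑ * ‖g y‖ₑ).toReal) := by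
    rw [memWLp_two_iff hIm.ennreal_toReal.aestronglyMeasurable]
    refine lt_of_le_of_lt (lintegral_mono fun x => ?_)
      (lintegral_kernel_conv_lt_top hn hσ hΓ.norm_le hg1 hg2)
    gcongr
    rw [Real.enorm_of_nonneg ENNReal.toReal_nonneg]
    exact ENNReal.ofReal_toReal_le
  have hloc := locallyIntegrable_of_memLp_restrict (p := 2) (by norm_num)
    (fun R => hI.memLp_restrict R)
  have hint := hloc.integrable_smul_left_of_hasCompactSupport hφ hφc
  rw [integrable_prod_iff hm]
  constructor
  · filter_upwards [hΓ.ae_integrable hn hσ hg1 hg2] with x hx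
    exact hx.smul (φ x)
  · refine hint.norm.congr ?_
    filter_upwards with x
    simp only [norm_smul, norm_mul]
    have hmx : AEStronglyMeasurable (fun y => ‖Γ (x - y)‖ * ‖g y‖) volume :=
      ((hΓ.measurable.comp (measurable_const.sub measurable_id)).norm.aestronglyMeasurable).mul
        hg2.aestronglyMeasurable.norm
    rw [integral_const_mul, integral_eq_lintegral_of_nonneg_ae
      (Filter.Eventually.of_forall fun y => mul_nonneg (norm_nonneg _) (norm_nonneg _)) hmx,
      Real.norm_of_nonneg ENNReal.toReal_nonneg]
    congr 3 with y
    rw [ENNReal.ofReal_mul (norm_nonneg _), ofReal_norm, ofReal_norm]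

end IsGreenKernel

end KernelConvolution

/-! ### The weak gradient of the Green potential. -/

section KernelDerivative

variable {n : ℕ}

lemma locallyIntegrable_greenBound (hn : 2 ≤ n) :
    LocallyIntegrable (fun z : E n => ‖z‖ ^ (-(((n : ℝ) - 1) / 2))
      + ‖z‖ ^ (-(((n : ℝ) - 1) / 2) - 1)) volume := by
  have hn' : (2 : ℝ) ≤ n := by exact_mod_cast hn
  set α : ℝ := ((n : ℝ) - 1) / 2 with hα
  have hα0 : 0 < α := by rw [hα]; linarith
  have h1 : Integrable ((Metric.closedBall (0 : E n) 1).indicator (fun z => ‖z‖ ^ (-α - 1)))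
      volume := by
    refine ⟨(Measurable.indicator (by fun_prop) measurableSet_closedBall).aestronglyMeasurable, ?_⟩
    have h := lintegral_near_kernel_ne_top hn
    rw [HasFiniteIntegral]
    refine lt_of_eq_of_lt (lintegral_congr fun z => ?_) h.lt_top
    by_cases hz : z ∈ Metric.closedBall (0 : E n) 1
    · rw [Set.indicator_of_mem hz, Set.indicator_of_mem hz, Real.enorm_of_nonneg (by positivity)]
    · rw [Set.indicator_of_notMem hz, Set.indicator_of_notMem hz, enorm_zero]
  have h2 : LocallyIntegrable (fun z : E n => 2 * 2 ^ (α / 2) * bracket (-α) z) volume :=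
    (continuous_const.mul (continuous_bracket _)).locallyIntegrable
  refine ((h1.const_mul 2).locallyIntegrable.add h2).mono ?_ ?_
  · exact Measurable.aestronglyMeasurable (by fun_prop)
  · filter_upwards with z
    rw [Real.norm_of_nonneg (by positivity)]
    exact (kernel_le_near_add_far hα0 z rfl).trans (le_abs_self _)

/-- The radial kernel `z ↦ G(|z|)`. -/
def radialKernel (G : ℝ → ℂ) (z : E n) : ℂ := G ‖z‖

/-- The `i`-th partial derivative of the radial kernel with radial derivative `G'`. -/
def radialKernelPartial (G' : ℝ → ℂ) (i : Fin n) (z : E n) : ℂ := ((z i / ‖z‖ : ℝ) : ℂ) * G' ‖z‖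

lemma abs_apply_div_le_one (z : E n) (i : Fin n) {r : ℝ} (h : ‖z‖ ≤ r) : |z i / r| ≤ 1 := by
  have h1 : |z i| ≤ ‖z‖ := PiLp.norm_apply_le z i
  rw [abs_div, abs_of_nonneg ((norm_nonneg z).trans h)]
  exact div_le_one_of_le₀ (h1.trans h) ((norm_nonneg z).trans h)

namespace KernelBound

variable {G G' : ℝ → ℂ} {C : ℝ}

lemma continuousOn_kernel {α : ℝ} (h : KernelBound α G G' C) : ContinuousOn G (Set.Ioi 0) :=
  fun r hr => (h.hasDerivAt r hr).continuousAt.continuousWithinAt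

lemma isGreenKernel (hn : 2 ≤ n) (h : KernelBound (((n : ℝ) - 1) / 2) G G' C) :
    IsGreenKernel C (radialKernel G : E n → ℂ) := by
  have hn' : (2 : ℝ) ≤ n := by exact_mod_cast hn
  refine ⟨measurable_of_continuousOn_compl_singleton 0 ?_, fun z => ?_⟩
  · exact h.continuousOn_kernel.comp continuous_norm.continuousOn fun z hz => norm_pos_iff.2 hz
  · rcases eq_or_ne z 0 with rfl | hz
    · simp only [radialKernel, norm_zero, h.zero]
      rw [Real.zero_rpow (by linarith), Real.zero_rpow (by linarith)]; simp
    · exact h.norm_le _ (norm_pos_iff.2 hz)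

lemma isGreenKernel_partial (hn : 2 ≤ n) (h : KernelBound (((n : ℝ) - 1) / 2) G G' C)
    (i : Fin n) : IsGreenKernel C (radialKernelPartial G' i : E n → ℂ) := by
  have hn' : (2 : ℝ) ≤ n := by exact_mod_cast hn
  refine ⟨measurable_of_continuousOn_compl_singleton 0 ?_, fun z => ?_⟩
  · have h1 : ContinuousOn (fun z : E n => z i / ‖z‖) {0}ᶜ :=
      ContinuousOn.div (by fun_prop) (by fun_prop) fun z hz => norm_ne_zero_iff.2 hz
    have h2 : ContinuousOn (fun z : E n => G' ‖z‖) {0}ᶜ :=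
      h.continuousOn.comp continuous_norm.continuousOn fun z hz => norm_pos_iff.2 hz
    exact (Complex.continuous_ofReal.comp_continuousOn h1).mul h2
  · rcases eq_or_ne z 0 with rfl | hz
    · simp only [radialKernelPartial, norm_zero]
      rw [Real.zero_rpow (by linarith), Real.zero_rpow (by linarith)]; simp
    · rw [radialKernelPartial, norm_mul, Complex.norm_real, Real.norm_eq_abs]
      exact (mul_le_of_le_one_left (norm_nonneg _) (abs_apply_div_le_one z i le_rfl)).trans
        (h.norm_deriv_le _ (norm_pos_iff.2 hz))

lemma greenBound_anti {α r s : ℝ} (hα : 0 < α) (hr : 0 < r) (hrs : r ≤ s) :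
    s ^ (-α) + s ^ (-α - 1) ≤ r ^ (-α) + r ^ (-α - 1) :=
  add_le_add (Real.rpow_le_rpow_of_nonpos hr hrs (by linarith))
    (Real.rpow_le_rpow_of_nonpos hr hrs (by linarith))

/-- The classical derivative of the radial kernel is its weak derivative. -/
lemma integral_fderiv_smul_radialKernel (hn : 2 ≤ n) (hC : 0 ≤ C)
    (h : KernelBound (((n : ℝ) - 1) / 2) G G' C) (i : Fin n) {φ : E n → ℝ}
    (hφ : ContDiff ℝ ∞ φ) (hφc : HasCompactSupport φ) :
    ∫ x, (fderiv ℝ φ x (EuclideanSpace.single i 1)) • (radialKernel G x : ℂ)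
      = - ∫ x, φ x • radialKernelPartial G' i x := by
  have hn' : (2 : ℝ) ≤ n := by exact_mod_cast hn
  have hα0 : 0 < ((n : ℝ) - 1) / 2 := by linarith
  have hnt : Nontrivial (E n) := by
    have : Nonempty (Fin n) := ⟨⟨0, by omega⟩⟩
    infer_instance
  set v : E n := EuclideanSpace.single i 1 with hv
  -- Regularise the norm to `ρ_k = (|x|² + 1/(k+1))^{1/2}`, which is smooth, positive and at least
  -- `|x|`. Then `G ∘ ρ_k` is differentiable everywhere and ordinary integration by parts applies.
  -- The majorant decreases in `r`, so its value at `|x|` dominates all `k`; being locally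
  -- integrable, it allows passage to the limit.
  set ρ : ℕ → E n → ℝ := fun k x => Real.sqrt (‖x‖ ^ 2 + ((k : ℝ) + 1)⁻¹) with hρ
  have hk0 : ∀ k : ℕ, 0 < ((k : ℝ) + 1)⁻¹ := fun k => by positivity
  have hρarg : ∀ (k : ℕ) (x : E n), 0 < ‖x‖ ^ 2 + ((k : ℝ) + 1)⁻¹ := fun k x => by
    have := hk0 k; positivity
  have hρpos : ∀ k x, 0 < ρ k x := fun k x => Real.sqrt_pos.2 (hρarg k x)
  have hρle : ∀ k x, ‖x‖ ≤ ρ k x := fun k x => Real.le_sqrt_of_sq_le (by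
    have := hk0 k; linarith)
  have hρcont : ∀ k, Continuous (ρ k) := fun k => by fun_prop
  have hρder : ∀ k x, HasFDerivAt (ρ k) ((1 / (2 * ρ k x)) • ((2 : ℕ) • innerSL ℝ x)) x := by
    intro k x
    exact ((hasStrictFDerivAt_norm_sq x).hasFDerivAt.add_const _).sqrt (hρarg k x).ne'
  have hcomp : ∀ k x, HasFDerivAt (fun x => G (ρ k x))
      (((1 / (2 * ρ k x)) • ((2 : ℕ) • innerSL ℝ x)).smulRight (G' (ρ k x))) x := by
    intro k x
    refine ((h.hasDerivAt _ (hρpos k x)).hasFDerivAt.comp x (hρder k x)).congr_fderiv ?_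
    ext z
    simp only [ContinuousLinearMap.comp_apply, ContinuousLinearMap.toSpanSingleton_apply,
      ContinuousLinearMap.smulRight_apply]
  have hfd : ∀ k x, fderiv ℝ (fun x => G (ρ k x)) x v
      = ((x i / ρ k x : ℝ) : ℂ) * G' (ρ k x) := by
    intro k x
    rw [(hcomp k x).fderiv]
    have : inner ℝ x v = x i := by simp [hv, EuclideanSpace.inner_single_right]
    have hne := (hρpos k x).ne'
    simp only [ContinuousLinearMap.smulRight_apply, _root_.smul_apply, innerSL_apply_apply, this,
      nsmul_eq_mul, smul_eq_mul, Complex.real_smul]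
    congr 2
    field_simp
    simp
  have hGc : ∀ k, Continuous (fun x => G (ρ k x)) := fun k =>
    continuous_iff_continuousAt.2 fun x => (hcomp k x).continuousAt
  have hG'c : ∀ k, Continuous (fun x => ((x i / ρ k x : ℝ) : ℂ) * G' (ρ k x)) := fun k => by
    have h1 : Continuous fun x => G' (ρ k x) :=
      h.continuousOn.comp_continuous (hρcont k) (hρpos k)
    have h2 : Continuous fun x : E n => x i / ρ k x :=
      Continuous.div (by fun_prop) (hρcont k) fun x => (hρpos k x).ne'
    exact (Complex.continuous_ofReal.comp h2).mul h1
  have hφ1 : Continuous φ := hφ.continuous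
  have hdφ : Continuous fun x => fderiv ℝ φ x v :=
    (hφ.continuous_fderiv (by simp)).clm_apply continuous_const
  have hdφc : HasCompactSupport fun x => fderiv ℝ φ x v := hφc.fderiv_apply ℝ v
  have hibp : ∀ k, ∫ x, (fderiv ℝ φ x v) • G (ρ k x)
      = - ∫ x, φ x • (((x i / ρ k x : ℝ) : ℂ) * G' (ρ k x)) := by
    intro k
    have := integral_smul_fderiv_eq_neg_fderiv_smul_of_integrable (μ := (volume : Measure (E n)))
      (f := φ) (g := fun x => G (ρ k x)) (v := v)
      ((hdφ.smul (hGc k)).integrable_of_hasCompactSupport hdφc.smul_right)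
      (by simp_rw [hfd]
          exact (hφ1.smul (hG'c k)).integrable_of_hasCompactSupport hφc.smul_right)
      ((hφ1.smul (hGc k)).integrable_of_hasCompactSupport hφc.smul_right)
      (fun x _ => (hφ.differentiable (by simp)) x)
      (fun x _ => (hcomp k x).differentiableAt)
    simp_rw [hfd] at this
    rw [this, neg_neg]
  have hρlim : ∀ x, Filter.Tendsto (fun k => ρ k x) Filter.atTop (nhds ‖x‖) := by
    intro x
    have h1 : Filter.Tendsto (fun k : ℕ => ‖x‖ ^ 2 + ((k : ℝ) + 1)⁻¹) Filter.atTop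
        (nhds (‖x‖ ^ 2 + 0)) := by
      refine tendsto_const_nhds.add ?_
      simpa [one_div] using tendsto_one_div_add_atTop_nhds_zero_nat (𝕜 := ℝ)
    have := (Real.continuous_sqrt.tendsto _).comp h1
    rwa [add_zero, Real.sqrt_sq (norm_nonneg x)] at this
  have hae : ∀ᵐ x : E n, x ≠ 0 := by
    simp [ae_iff]
  have hKint : ∀ {ψ : E n → ℝ}, Continuous ψ → HasCompactSupport ψ →
      Integrable (fun x : E n => |ψ x| * (C * (‖x‖ ^ (-(((n : ℝ) - 1) / 2))
        + ‖x‖ ^ (-(((n : ℝ) - 1) / 2) - 1)))) volume := by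
    intro ψ hψ hψc
    have := (locallyIntegrable_greenBound hn).integrable_smul_left_of_hasCompactSupport
      hψ.abs (hψc.comp_left abs_zero)
    refine (this.const_mul C).congr (Filter.Eventually.of_forall fun x => ?_)
    simp only [smul_eq_mul]; ring
  have lim1 : Filter.Tendsto (fun k => ∫ x, (fderiv ℝ φ x v) • G (ρ k x)) Filter.atTop
      (nhds (∫ x, (fderiv ℝ φ x v) • (radialKernel G x : ℂ))) := by
    refine tendsto_integral_of_dominated_convergence _
      (fun k => (hdφ.smul (hGc k)).aestronglyMeasurable) (hKint hdφ hdφc) ?_ ?_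
    · intro k
      filter_upwards [hae] with x hx
      rw [norm_smul, Real.norm_eq_abs]
      gcongr
      refine (h.norm_le _ (hρpos k x)).trans ?_
      gcongr ?_ * ?_
      exact greenBound_anti hα0 (norm_pos_iff.2 hx) (hρle k x)
    · filter_upwards [hae] with x hx
      refine tendsto_const_nhds.smul ?_
      exact ((h.hasDerivAt _ (norm_pos_iff.2 hx)).continuousAt.tendsto).comp (hρlim x)
  have lim2 : Filter.Tendsto (fun k => ∫ x, φ x • (((x i / ρ k x : ℝ) : ℂ) * G' (ρ k x)))
      Filter.atTop (nhds (∫ x, φ x • radialKernelPartial G' i x)) := by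
    refine tendsto_integral_of_dominated_convergence _
      (fun k => (hφ1.smul (hG'c k)).aestronglyMeasurable) (hKint hφ1 hφc) ?_ ?_
    · intro k
      filter_upwards [hae] with x hx
      rw [norm_smul, Real.norm_eq_abs, norm_mul, Complex.norm_real, Real.norm_eq_abs]
      refine mul_le_mul_of_nonneg_left ?_ (abs_nonneg _)
      refine (mul_le_of_le_one_left (norm_nonneg _)
        (abs_apply_div_le_one x i (hρle k x))).trans ?_
      refine (h.norm_deriv_le _ (hρpos k x)).trans ?_
      gcongr ?_ * ?_
      exact greenBound_anti hα0 (norm_pos_iff.2 hx) (hρle k x)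
    · filter_upwards [hae] with x hx
      refine tendsto_const_nhds.smul (Filter.Tendsto.mul ?_ ?_)
      · refine (Complex.continuous_ofReal.tendsto _).comp ?_
        exact tendsto_const_nhds.div (hρlim x) (norm_ne_zero_iff.2 hx)
      · exact ((h.continuousOn.continuousAt
          (Ioi_mem_nhds (norm_pos_iff.2 hx))).tendsto).comp (hρlim x)
  simp_rw [hibp] at lim1
  exact tendsto_nhds_unique lim1 lim2.neg

lemma integral_fderiv_smul_radialKernel_sub (hn : 2 ≤ n) (hC : 0 ≤ C)
    (h : KernelBound (((n : ℝ) - 1) / 2) G G' C) (i : Fin n) {φ : E n → ℝ}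
    (hφ : ContDiff ℝ ∞ φ) (hφc : HasCompactSupport φ) (y : E n) :
    ∫ x, (fderiv ℝ φ x (EuclideanSpace.single i 1)) • (radialKernel G (x - y) : ℂ)
      = - ∫ x, φ x • radialKernelPartial G' i (x - y) := by
  have h1 := integral_fderiv_smul_radialKernel hn hC h i (φ := fun x => φ (x + y))
    (hφ.comp (contDiff_id.add contDiff_const))
    (hφc.comp_homeomorph (Homeomorph.addRight y))
  simp_rw [fderiv_comp_add_right] at h1
  rw [← integral_sub_right_eq_self _ y, ← integral_sub_right_eq_self (fun x => φ (x + y) • _) y] at h1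
  simpa using h1

/-- Fubini puts the test function on the kernel, where the translated integration by parts is
available for each fixed `y`; Fubini back gives the differentiated kernel. -/
lemma hasWeakPartial_integral (hn : 2 ≤ n) (hC : 0 ≤ C)
    (h : KernelBound (((n : ℝ) - 1) / 2) G G' C) {σ : ℝ} (hσ : (n : ℝ) / 2 < σ)
    {g : E n → ℂ} (hg1 : MemWLp 1 (-(((n : ℝ) - 1) / 2)) g) (hg2 : MemWLp 2 (-σ) g) (i : Fin n) :
    HasWeakPartial i (fun x => ∫ y, radialKernel G (x - y) * g y)
      (fun x => ∫ y, radialKernelPartial G' i (x - y) * g y) := by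
  have k1 := h.isGreenKernel hn
  have k2 := h.isGreenKernel_partial hn i
  refine ⟨locallyIntegrable_of_memLp_restrict (p := 2) (by norm_num)
      fun R => (k1.memWLp_integral hn hσ hg1 hg2).memLp_restrict R,
    locallyIntegrable_of_memLp_restrict (p := 2) (by norm_num)
      fun R => (k2.memWLp_integral hn hσ hg1 hg2).memLp_restrict R, fun φ hφ hφc => ?_⟩
  set v : E n := EuclideanSpace.single i 1 with hv
  have hdφ : Continuous fun x => fderiv ℝ φ x v :=
    (hφ.continuous_fderiv (by simp)).clm_apply continuous_const
  have hdφc : HasCompactSupport fun x => fderiv ℝ φ x v := hφc.fderiv_apply ℝ v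
  have swap : ∀ {Γ : E n → ℂ} {ψ : E n → ℝ}, IsGreenKernel C Γ → Continuous ψ →
      HasCompactSupport ψ → ∫ x, ψ x • ∫ y, Γ (x - y) * g y
        = ∫ y, (∫ x, ψ x • Γ (x - y)) * g y := by
    intro Γ ψ hΓ hψ hψc
    simp_rw [← integral_smul, ← integral_mul_const, smul_mul_assoc]
    exact integral_integral_swap (hΓ.integrable_prod hn hσ hg1 hg2 hψ hψc)
  rw [swap k1 hdφ hdφc, swap k2 hφ.continuous hφc, ← integral_neg]
  congr 1 with y
  rw [integral_fderiv_smul_radialKernel_sub hn hC h i hφ hφc y, neg_mul]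

end KernelBound

end KernelDerivative

/-! ### Calculus of weak derivatives. -/

section WeakDerivative

variable {n : ℕ} {F : Type*} [NormedAddCommGroup F] [NormedSpace ℝ F]

section WeakPartial

lemma continuous_fderiv_apply {φ : E n → F} (hφ : ContDiff ℝ ∞ φ) (v : E n) :
    Continuous fun x => fderiv ℝ φ x v :=
  (hφ.continuous_fderiv (by simp)).clm_apply continuous_const

lemma locallyIntegrable_continuous_smul {f : E n → F} (hf : LocallyIntegrable f volume)
    {ψ : E n → ℝ} (hψ : Continuous ψ) : LocallyIntegrable (fun x => ψ x • f x) volume := by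
  rw [← locallyIntegrableOn_univ] at hf ⊢
  exact hf.continuousOn_smul isOpen_univ.isLocallyClosed hψ.continuousOn

lemma HasWeakPartial.ae_eq [CompleteSpace F] {i : Fin n} {f g g' : E n → F}
    (h : HasWeakPartial i f g) (h' : HasWeakPartial i f g') : g =ᵐ[volume] g' := by
  refine ae_eq_of_integral_contDiff_smul_eq h.2.1 h'.2.1 fun φ hφ hφc => ?_
  exact neg_injective ((h.2.2 φ hφ hφc).symm.trans (h'.2.2 φ hφ hφc))

/-- Weak derivatives are unique up to null sets, so the arbitrary choice in `weakPartial` does not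
affect any integral. -/
lemma HasWeakPartial.weakPartial_ae_eq [CompleteSpace F] {i : Fin n} {f g : E n → F}
    (h : HasWeakPartial i f g) : weakPartial i f =ᵐ[volume] g := by
  have hex : ∃ g, HasWeakPartial i f g := ⟨g, h⟩
  rw [weakPartial, dif_pos hex]
  exact hex.choose_spec.ae_eq h

lemma HasWeakPartial.clm_comp [CompleteSpace F] {F' : Type*} [NormedAddCommGroup F']
    [NormedSpace ℝ F'] [CompleteSpace F'] {i : Fin n} {f g : E n → F} (h : HasWeakPartial i f g)
    (L : F →L[ℝ] F') : HasWeakPartial i (fun x => L (f x)) (fun x => L (g x)) := by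
  have hloc : ∀ {f : E n → F}, LocallyIntegrable f volume →
      LocallyIntegrable (fun x => L (f x)) volume := fun hf =>
    locallyIntegrable_iff.2 fun k hk => L.integrable_comp (hf.integrableOn_isCompact hk)
  refine ⟨hloc h.1, hloc h.2.1, fun φ hφ hφc => ?_⟩
  have h1 := h.2.2 φ hφ hφc
  have i1 := h.1.integrable_smul_left_of_hasCompactSupport
    (continuous_fderiv_apply hφ (EuclideanSpace.single i 1)) (hφc.fderiv_apply ℝ _)
  have i2 := h.2.1.integrable_smul_left_of_hasCompactSupport hφ.continuous hφc
  simp_rw [← map_smul L]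
  rw [L.integral_comp_comm i1, L.integral_comp_comm i2, h1, map_neg]

/-- Product rule with a smooth factor. -/
lemma HasWeakPartial.contDiff_smul {i : Fin n} {f g : E n → F} (h : HasWeakPartial i f g)
    {ψ : E n → ℝ} (hψ : ContDiff ℝ ∞ ψ) :
    HasWeakPartial i (fun x => ψ x • f x)
      (fun x => fderiv ℝ ψ x (EuclideanSpace.single i 1) • f x + ψ x • g x) := by
  set v : E n := EuclideanSpace.single i 1 with hv
  have hdψ := continuous_fderiv_apply hψ v
  have l1 := locallyIntegrable_continuous_smul h.1 hdψ
  have l2 := locallyIntegrable_continuous_smul h.2.1 hψ.continuous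
  have l3 := locallyIntegrable_continuous_smul h.1 hψ.continuous
  refine ⟨l3, l1.add l2, fun φ hφ hφc => ?_⟩
  have h1 := h.2.2 (fun x => φ x * ψ x) (hφ.mul hψ) hφc.mul_right
  have hd : ∀ x, fderiv ℝ (fun x => φ x * ψ x) x v = φ x * fderiv ℝ ψ x v + fderiv ℝ φ x v * ψ x := by
    intro x
    rw [fderiv_fun_mul ((hφ.differentiable (by simp)) x) ((hψ.differentiable (by simp)) x)]
    simp [mul_comm]
  simp_rw [← hv, hd, add_smul, mul_smul] at h1
  have i1 := l1.integrable_smul_left_of_hasCompactSupport hφ.continuous hφc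
  have i2 := l2.integrable_smul_left_of_hasCompactSupport hφ.continuous hφc
  have i3 := l3.integrable_smul_left_of_hasCompactSupport (continuous_fderiv_apply hφ v)
    (hφc.fderiv_apply ℝ v)
  rw [integral_add i1 i3] at h1
  simp_rw [smul_add]
  rw [integral_add i1 i2, neg_add, ← h1]
  abel

/-- The classical partial derivative of a smooth function is its weak derivative. -/
lemma hasWeakPartial_of_contDiff (i : Fin n) {u : E n → F} (hu : ContDiff ℝ ∞ u) :
    HasWeakPartial i u (fun x => fderiv ℝ u x (EuclideanSpace.single i 1)) := by
  set v : E n := EuclideanSpace.single i 1 with hv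
  have hdu := continuous_fderiv_apply hu v
  refine ⟨hu.continuous.locallyIntegrable, hdu.locallyIntegrable, fun φ hφ hφc => ?_⟩
  have hdφ := continuous_fderiv_apply hφ v
  have := integral_smul_fderiv_eq_neg_fderiv_smul_of_integrable (μ := (volume : Measure (E n)))
    (f := φ) (g := u) (v := v)
    ((hdφ.smul hu.continuous).integrable_of_hasCompactSupport (hφc.fderiv_apply ℝ v).smul_right)
    ((hφ.continuous.smul hdu).integrable_of_hasCompactSupport hφc.smul_right)
    ((hφ.continuous.smul hu.continuous).integrable_of_hasCompactSupport hφc.smul_right)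
    (fun x _ => (hφ.differentiable (by simp)) x) (fun x _ => (hu.differentiable (by simp)) x)
  rw [this, neg_neg]

end WeakPartial

/-! ### Mollification and its convergence in `L²` and almost everywhere. -/

section Mollify

/-- A sequence of bump functions shrinking to the origin. -/
def bump (n k : ℕ) : ContDiffBump (0 : E n) where
  rIn := 1 / (2 * ((k : ℝ) + 1))
  rOut := 1 / ((k : ℝ) + 1)
  rIn_pos := by positivity
  rIn_lt_rOut := by
    have : (0 : ℝ) < (k : ℝ) + 1 := by positivity
    exact one_div_lt_one_div_of_lt this (by linarith)

lemma tendsto_bump_rOut : Filter.Tendsto (fun k => (bump n k).rOut) Filter.atTop (nhds 0) :=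
  tendsto_one_div_add_atTop_nhds_zero_nat

/-- Mollification at scale `1 / (k + 1)`. -/
def mollify (k : ℕ) (u : E n → ℝ) : E n → ℝ :=
  convolution ((bump n k).normed volume) u (ContinuousLinearMap.lsmul ℝ ℝ) volume

lemma mollify_apply (k : ℕ) (u : E n → ℝ) (x : E n) :
    mollify k u x = ∫ y, (bump n k).normed volume (x - y) * u y := by
  rw [mollify, convolution_eq_swap]; rfl

lemma contDiff_mollify (k : ℕ) {u : E n → ℝ} (hu : LocallyIntegrable u volume) :
    ContDiff ℝ ∞ (mollify k u) :=
  HasCompactSupport.contDiff_convolution_left _ (bump n k).hasCompactSupport_normed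
    (bump n k).contDiff_normed hu

/-- The derivative falls on the bump. As a function of `y`, the translate `ρ(x - y)` is a test
function whose derivative has the opposite sign, so the definition of the weak derivative transfers
it to `u`. -/
lemma fderiv_mollify (k : ℕ) {i : Fin n} {u v : E n → ℝ} (h : HasWeakPartial i u v) (x : E n) :
    fderiv ℝ (mollify k u) x (EuclideanSpace.single i 1) = mollify k v x := by
  set e : E n := EuclideanSpace.single i 1 with he
  set ρ := (bump n k).normed (volume : Measure (E n)) with hρ
  have hρs : ContDiff ℝ ∞ ρ := (bump n k).contDiff_normed
  have hρc : HasCompactSupport ρ := (bump n k).hasCompactSupport_normed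
  have h1 := (hρc.hasFDerivAt_convolution_left (ContinuousLinearMap.lsmul ℝ ℝ)
    (hρs.of_le (by simp)) h.1 x).fderiv
  have hex : ConvolutionExistsAt (fderiv ℝ ρ) u x
      (ContinuousLinearMap.precompL (E n) (ContinuousLinearMap.lsmul ℝ ℝ)) volume :=
    (hρc.fderiv ℝ).convolutionExists_left _ (hρs.continuous_fderiv (by simp)) h.1 x
  have h2 : fderiv ℝ (mollify k u) x e = ∫ y, fderiv ℝ ρ (x - y) e * u y := by
    rw [mollify, h1, convolution_def, ContinuousLinearMap.integral_apply hex]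
    rw [← integral_sub_left_eq_self _ _ x]
    simp [ContinuousLinearMap.precompL]
  have hφ : ContDiff ℝ ∞ fun y => ρ (x - y) := hρs.comp (contDiff_const.sub contDiff_id)
  have hφc : HasCompactSupport fun y => ρ (x - y) :=
    hρc.comp_homeomorph (Homeomorph.subLeft x)
  have hd : ∀ y, fderiv ℝ (fun y => ρ (x - y)) y e = - fderiv ℝ ρ (x - y) e := by
    intro y
    have h4 : HasFDerivAt (fun y : E n => x - y) (-(ContinuousLinearMap.id ℝ (E n))) y :=
      (hasFDerivAt_id y).const_sub x
    have h5 := ((hρs.differentiable (by simp)) (x - y)).hasFDerivAt.comp y h4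
    have h6 : fderiv ℝ (fun y => ρ (x - y)) y = _ := h5.fderiv
    rw [h6]
    simp
  have h3 := h.2.2 _ hφ hφc
  simp_rw [← he, hd, smul_eq_mul, neg_mul, integral_neg] at h3
  rw [h2, mollify_apply]
  exact neg_injective h3

lemma ae_tendsto_mollify {u : E n → ℝ} (hu : LocallyIntegrable u volume) :
    ∀ᵐ x, Filter.Tendsto (fun k => mollify k u x) Filter.atTop (nhds (u x)) := by
  -- The constant 2 is the ratio of outer to inner radius of the bumps; its boundedness is what
  -- Lebesgue differentiation needs.
  refine ContDiffBump.ae_convolution_tendsto_right_of_locallyIntegrable (K := 2)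
    tendsto_bump_rOut (Filter.Eventually.of_forall fun k => ?_) hu
  simp only [bump]
  apply le_of_eq
  field_simp

lemma eLpNorm_two_sq {X : Type*} [MeasurableSpace X] {μ : Measure X} {G : Type*}
    [NormedAddCommGroup G] (f : X → G) : eLpNorm f 2 μ ^ 2 = ∫⁻ x, ‖f x‖ₑ ^ 2 ∂μ := by
  have := eLpNorm_nnreal_pow_eq_lintegral (f := f) (μ := μ) (p := 2) (by norm_num)
  simpa using this

/-- Young's inequality with trivial weight, since the bump has mass one. -/
lemma eLpNorm_mollify_le (k : ℕ) {u : E n → ℝ} (hu : AEStronglyMeasurable u volume) :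
    eLpNorm (mollify k u) 2 volume ≤ eLpNorm u 2 volume := by
  set ρ := (bump n k).normed (volume : Measure (E n)) with hρ
  have hρm : Measurable fun z => ‖ρ z‖ₑ := (bump n k).continuous_normed.measurable.enorm
  have hρ1 : ∫⁻ z, ‖ρ z‖ₑ = 1 := by
    have h0 : ∀ z, ‖ρ z‖ₑ = ENNReal.ofReal (ρ z) := fun z =>
      Real.enorm_of_nonneg ((bump n k).nonneg_normed z)
    simp_rw [h0]
    rw [← ofReal_integral_eq_lintegral_ofReal (bump n k).integrable_normed
      (Filter.Eventually.of_forall (bump n k).nonneg_normed), (bump n k).integral_normed,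
      ENNReal.ofReal_one]
  have h := lintegral_conv_sq_le (k := fun z => ‖ρ z‖ₑ) (g := fun y => ‖u y‖ₑ) (w := 1) (D := 1)
    hρm hu.enorm measurable_one (fun x y => by simp)
  simp only [Pi.one_apply, mul_one, hρ1, one_pow, one_mul] at h
  rw [← ENNReal.pow_le_pow_left_iff two_ne_zero, eLpNorm_two_sq, eLpNorm_two_sq]
  refine (lintegral_mono fun x => ?_).trans h
  gcongr
  rw [mollify_apply]
  refine (enorm_integral_le_lintegral_enorm _).trans (le_of_eq ?_)
  simp [enorm_mul, hρ]

lemma mollify_sub (k : ℕ) {u v : E n → ℝ} (hu : LocallyIntegrable u volume)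
    (hv : LocallyIntegrable v volume) : mollify k (u - v) = mollify k u - mollify k v := by
  have hex : ∀ {w : E n → ℝ}, LocallyIntegrable w volume → ConvolutionExists
      ((bump n k).normed volume) w (ContinuousLinearMap.lsmul ℝ ℝ) volume := fun hw =>
    (bump n k).hasCompactSupport_normed.convolutionExists_left _ (bump n k).continuous_normed hw
  have h := (hex (hu.sub hv)).distrib_add (hex hv)
  rw [sub_add_cancel] at h
  exact eq_sub_of_add_eq h.symm

lemma mollify_eq_zero (k : ℕ) {u : E n → ℝ} {R : ℝ} (hu : ∀ x, R < ‖x‖ → u x = 0) {x : E n}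
    (hx : R + 1 < ‖x‖) : mollify k u x = 0 := by
  rw [mollify_apply]
  refine integral_eq_zero_of_ae (Filter.Eventually.of_forall fun y => ?_)
  rcases le_or_gt ‖y‖ R with h | h
  · have h1 : 1 < ‖x - y‖ := by
      have := norm_sub_norm_le x y; linarith
    have h2 : (bump n k).rOut ≤ 1 := by
      simp only [bump]
      exact div_le_one_of_le₀ (by have : (0 : ℝ) ≤ k := by positivity
                                  linarith) (by positivity)
    have : (bump n k).normed volume (x - y) = 0 := by
      rw [← Function.notMem_support, (bump n k).support_normed_eq]
      simp only [Metric.mem_ball, dist_zero_right, not_lt]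
      linarith
    simp [this]
  · simp [hu y h]

lemma tendsto_mollify_of_continuous {g : E n → ℝ} (hg : Continuous g) (hgc : HasCompactSupport g) :
    Filter.Tendsto (fun k => eLpNorm (mollify k g - g) 2 volume) Filter.atTop (nhds 0) := by
  obtain ⟨M, hM⟩ := hg.bounded_above_of_compact_support hgc
  obtain ⟨R, hR⟩ := hgc.isCompact.isBounded.subset_closedBall 0
  have hR' : ∀ x, R < ‖x‖ → g x = 0 := fun x hx => by
    by_contra h
    have := hR (subset_tsupport g h)
    simp at this; linarith
  have hb : ∀ k x, ‖mollify k g x - g x‖ ≤ 2 * M := by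
    intro k x
    rw [← dist_eq_norm]
    refine ContDiffBump.dist_normed_convolution_le hg.aestronglyMeasurable fun y _ => ?_
    rw [dist_eq_norm]
    refine (norm_sub_le _ _).trans ?_
    linarith [hM x, hM y]
  have hz : ∀ k x, R + 1 < ‖x‖ → mollify k g x - g x = 0 := fun k x hx => by
    rw [mollify_eq_zero k hR' hx, hR' x (by linarith), sub_zero]
  have hlim : Filter.Tendsto (fun k => ∫⁻ x, ‖(mollify k g - g) x‖ₑ ^ 2) Filter.atTop
      (nhds (∫⁻ _ : E n, 0)) := by
    refine tendsto_lintegral_of_dominated_convergence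
      ((Metric.closedBall (0 : E n) (R + 1)).indicator fun _ => ENNReal.ofReal (2 * M) ^ 2) ?_ ?_ ?_ ?_
    · intro k
      have := (contDiff_mollify k hg.locallyIntegrable).continuous.sub hg
      exact this.measurable.enorm.pow_const 2
    · intro k
      filter_upwards with x
      by_cases hx : ‖x‖ ≤ R + 1
      · rw [Set.indicator_of_mem (by simpa using hx)]
        gcongr
        rw [← ofReal_norm]
        exact ENNReal.ofReal_le_ofReal (hb k x)
      · rw [Pi.sub_apply, hz k x (not_le.1 hx)]
        simp
    · rw [lintegral_indicator measurableSet_closedBall]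
      simp only [lintegral_const, Measure.restrict_apply_univ]
      have : volume (Metric.closedBall (0 : E n) (R + 1)) ≠ ⊤ := measure_closedBall_lt_top.ne
      finiteness
    · filter_upwards with x
      have h1 := ContDiffBump.convolution_tendsto_right_of_continuous (μ := (volume : Measure (E n)))
        (tendsto_bump_rOut (n := n)) hg x
      have h2 := (h1.sub_const (g x)).enorm
      have h3 := ((ENNReal.continuous_pow 2).tendsto _).comp h2
      simpa [Function.comp_def, mollify] using h3
  simp_rw [← eLpNorm_two_sq] at hlim
  rw [lintegral_zero] at hlim
  have := (ENNReal.continuous_rpow_const (y := 1 / 2)).tendsto _ |>.comp hlim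
  have h4 : ∀ t : ENNReal, (t ^ 2) ^ (1 / 2 : ℝ) = t := fun t => by
    rw [← ENNReal.rpow_natCast, ← ENNReal.rpow_mul]; norm_num
  simp only [Function.comp_def, h4] at this
  simpa using this

/-- Continuous compactly supported functions are dense in `L²`, and mollification is a contraction
there, so three errors of size `ε/3` suffice. -/
lemma tendsto_mollify {u : E n → ℝ} (hu : MemLp u 2 volume) :
    Filter.Tendsto (fun k => eLpNorm (mollify k u - u) 2 volume) Filter.atTop (nhds 0) := by
  rw [ENNReal.tendsto_atTop_zero]
  intro ε hε
  have hε3 : ε / 3 ≠ 0 := (ENNReal.div_pos hε.ne' (by simp)).ne'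
  obtain ⟨g, hgc, hug, hg, hgm⟩ := hu.exists_hasCompactSupport_eLpNorm_sub_le (by simp) hε3
  obtain ⟨N, hN⟩ := (ENNReal.tendsto_atTop_zero.1 (tendsto_mollify_of_continuous hg hgc)) _
    (pos_iff_ne_zero.2 hε3)
  refine ⟨N, fun k hk => ?_⟩
  have hul := hu.locallyIntegrable (by norm_num : (1 : ENNReal) ≤ 2)
  have hgl := hg.locallyIntegrable (μ := (volume : Measure (E n)))
  have hum : AEStronglyMeasurable (u - g) volume := hu.1.sub hg.aestronglyMeasurable
  have e : mollify k u - u = mollify k (u - g) + (mollify k g - g) + (g - u) := by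
    rw [mollify_sub k hul hgl]; abel
  have m1 : AEStronglyMeasurable (mollify k (u - g)) volume :=
    (contDiff_mollify k (hul.sub hgl)).continuous.aestronglyMeasurable
  have m2 : AEStronglyMeasurable (mollify k g - g) volume :=
    ((contDiff_mollify k hgl).continuous.sub hg).aestronglyMeasurable
  have m3 : AEStronglyMeasurable (g - u) volume := hg.aestronglyMeasurable.sub hu.1
  rw [e]
  calc _ ≤ eLpNorm (mollify k (u - g)) 2 volume + eLpNorm (mollify k g - g) 2 volume
        + eLpNorm (g - u) 2 volume :=
        (eLpNorm_add_le (m1.add m2) m3 (by norm_num)).trans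
          (add_le_add_left (eLpNorm_add_le m1 m2 (by norm_num)) _)
    _ ≤ ε / 3 + ε / 3 + ε / 3 := by
        gcongr
        · exact (eLpNorm_mollify_le k hum).trans hug
        · exact hN k hk
        · rw [eLpNorm_sub_comm]; exact hug
    _ = ε := ENNReal.add_thirds ε

end Mollify

end WeakDerivative

/-! ### The product rule in `L²_loc`. -/

section ProductRule

variable {n : ℕ} {F : Type*} [NormedAddCommGroup F] [NormedSpace ℝ F]

lemma memLp_smul_of_support {ψ w : E n → ℝ} {R : ℝ} (hψ : Continuous ψ)
    (hψR : ∀ x, R < ‖x‖ → ψ x = 0) (hw : MemLp w 2 (volume.restrict (Metric.closedBall 0 R))) :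
    MemLp (fun x => ψ x • w x) 2 volume := by
  have h1 : (fun x => ψ x • w x)
      = (Metric.closedBall (0 : E n) R).indicator (fun x => ψ x • w x) := by
    ext x
    by_cases hx : ‖x‖ ≤ R
    · rw [Set.indicator_of_mem (by simpa using hx)]
    · rw [Set.indicator_of_notMem (by simpa using hx), hψR x (not_le.1 hx), zero_smul]
  rw [h1, memLp_indicator_iff_restrict measurableSet_closedBall]
  obtain ⟨M, hM⟩ := (isCompact_closedBall (0 : E n) R).exists_bound_of_continuousOn
    hψ.continuousOn
  refine MemLp.of_le_mul (c := M) hw (hψ.aestronglyMeasurable.smul hw.1) ?_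
  filter_upwards [ae_restrict_mem measurableSet_closedBall] with x hx
  rw [norm_smul]
  gcongr
  exact hM x hx

/-- Mollification enlarges the support by at most one, so `g` matters only on the ball of radius `R
+ 1`, where it is square integrable. The limit is then `L²` convergence paired with an `L²`
function. -/
lemma tendsto_integral_mollify_smul {u : E n → ℝ} {g : E n → F} {R : ℝ} (hu : MemLp u 2 volume)
    (huR : ∀ x, R < ‖x‖ → u x = 0)
    (hg : MemLp g 2 (volume.restrict (Metric.closedBall 0 (R + 1)))) :
    Filter.Tendsto (fun k => ∫ x, mollify k u x • g x) Filter.atTop (nhds (∫ x, u x • g x)) := by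
  set g₁ := (Metric.closedBall (0 : E n) (R + 1)).indicator g with hg₁
  have hg1 : MemLp g₁ 2 volume := (memLp_indicator_iff_restrict measurableSet_closedBall).2 hg
  have hcut : ∀ {v : E n → ℝ}, (∀ x, R + 1 < ‖x‖ → v x = 0) → ∀ x, v x • g x = v x • g₁ x := by
    intro v hv x
    by_cases hx : ‖x‖ ≤ R + 1
    · rw [hg₁, Set.indicator_of_mem (by simpa using hx)]
    · rw [hv x (not_le.1 hx), zero_smul, zero_smul]
  have hul := hu.locallyIntegrable (by norm_num : (1 : ENNReal) ≤ 2)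
  have hmk : ∀ k, MemLp (mollify k u) 2 volume := fun k =>
    ⟨(contDiff_mollify k hul).continuous.aestronglyMeasurable,
      (eLpNorm_mollify_le k hu.1).trans_lt hu.2⟩
  have hint : ∀ {v : E n → ℝ}, MemLp v 2 volume → Integrable (fun x => v x • g₁ x) volume :=
    fun hv => memLp_one_iff_integrable.1 (MemLp.smul (r := 1) hg1 hv)
  simp_rw [hcut fun x hx => huR x (by linarith)]
  have : ∀ k x, mollify k u x • g x = mollify k u x • g₁ x :=
    fun k => hcut fun x hx => mollify_eq_zero k huR hx
  simp_rw [this]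
  refine tendsto_integral_of_L1 _ (hint hu).1
    (Filter.Eventually.of_forall fun k => hint (hmk k)) ?_
  have h0 : Filter.Tendsto (fun k => eLpNorm (mollify k u - u) 2 volume * eLpNorm g₁ 2 volume)
      Filter.atTop (nhds 0) := by
    have := ENNReal.Tendsto.mul_const (tendsto_mollify hu) (b := eLpNorm g₁ 2 volume)
      (Or.inr hg1.2.ne)
    simpa using this
  refine tendsto_of_tendsto_of_tendsto_of_le_of_le tendsto_const_nhds h0 (fun _ => zero_le)
    fun k => ?_
  have h1 := eLpNorm_smul_le_mul_eLpNorm (r := 1) hg1.1 ((hmk k).1.sub hu.1) (p := 2) (q := 2)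
  rw [eLpNorm_one_eq_lintegral_enorm] at h1
  refine le_trans (le_of_eq (lintegral_congr fun x => ?_)) h1
  simp [sub_smul]

/-- Product rule for weak derivatives in `L²_loc`. -/
lemma HasWeakPartial.smul {i : Fin n} {w dw : E n → ℝ} {f g : E n → F}
    (hw : HasWeakPartial i w dw) (hf : HasWeakPartial i f g)
    (hw2 : ∀ R, MemLp w 2 (volume.restrict (Metric.closedBall 0 R)))
    (hdw2 : ∀ R, MemLp dw 2 (volume.restrict (Metric.closedBall 0 R)))
    (hf2 : ∀ R, MemLp f 2 (volume.restrict (Metric.closedBall 0 R)))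
    (hg2 : ∀ R, MemLp g 2 (volume.restrict (Metric.closedBall 0 R))) :
    HasWeakPartial i (fun x => w x • f x) (fun x => dw x • f x + w x • g x) := by
  set e : E n := EuclideanSpace.single i 1 with he
  have hloc : ∀ {a : E n → ℝ} {b : E n → F},
      (∀ R, MemLp a 2 (volume.restrict (Metric.closedBall 0 R))) →
      (∀ R, MemLp b 2 (volume.restrict (Metric.closedBall 0 R))) →
      LocallyIntegrable (fun x => a x • b x) volume := fun ha hb =>
    locallyIntegrable_of_memLp_restrict le_rfl fun R => MemLp.smul (r := 1) (hb R) (ha R)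
  have l1 := hloc hw2 hf2
  have l2 := hloc hdw2 hf2
  have l3 := hloc hw2 hg2
  refine ⟨l1, l2.add l3, fun φ hφ hφc => ?_⟩
  obtain ⟨R, hR⟩ := hφc.isCompact.isBounded.subset_closedBall 0
  have hφR : ∀ x, R < ‖x‖ → φ x = 0 := fun x hx => by
    by_contra h
    have := hR (subset_tsupport φ h)
    simp at this; linarith
  have hdφR : ∀ x, R < ‖x‖ → fderiv ℝ φ x e = 0 := fun x hx => by
    by_contra h
    have : x ∈ tsupport φ := by
      by_contra hx'
      exact h (by rw [fderiv_of_notMem_tsupport ℝ hx']; simp)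
    have := hR this
    simp at this; linarith
  have hdφ := continuous_fderiv_apply hφ e
  have hu := memLp_smul_of_support hφ.continuous hφR (hw2 R)
  have hv : MemLp (fun x => fderiv ℝ φ x e • w x + φ x • dw x) 2 volume :=
    (memLp_smul_of_support hdφ hdφR (hw2 R)).add
      (memLp_smul_of_support hφ.continuous hφR (hdw2 R))
  have huv := hw.contDiff_smul hφ
  have huR : ∀ x, R < ‖x‖ → φ x • w x = 0 := fun x hx => by rw [hφR x hx, zero_smul]
  have hvR : ∀ x, R < ‖x‖ → fderiv ℝ φ x e • w x + φ x • dw x = 0 := fun x hx => by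
    rw [hφR x hx, hdφR x hx, zero_smul, zero_smul, add_zero]
  have lim1 := tendsto_integral_mollify_smul hv hvR (hf2 (R + 1))
  have lim2 := tendsto_integral_mollify_smul hu huR (hg2 (R + 1))
  -- The function `φ w` is not smooth, but its mollification is an admissible test function for the
  -- weak derivative of `f`. Its classical derivative is the mollification of `∂φ w + φ dw`, so
  -- letting `k → ∞` gives the product rule tested on `φ`.
  have hk : ∀ k, ∫ x, mollify k (fun x => fderiv ℝ φ x e • w x + φ x • dw x) x • f x
      = - ∫ x, mollify k (fun x => φ x • w x) x • g x := by
    intro k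
    have hsm := contDiff_mollify k huv.1
    have hcs : HasCompactSupport (mollify k fun x => φ x • w x) :=
      HasCompactSupport.of_support_subset_isCompact (isCompact_closedBall (0 : E n) (R + 1))
        fun x hx => by
          by_contra h
          exact hx (mollify_eq_zero k huR (by simpa using h))
    have := hf.2.2 _ hsm hcs
    simp_rw [fderiv_mollify k huv] at this
    exact this
  simp_rw [hk] at lim1
  have key := tendsto_nhds_unique lim1 lim2.neg
  have i1 := l1.integrable_smul_left_of_hasCompactSupport hdφ (hφc.fderiv_apply ℝ e)
  have i2 := l2.integrable_smul_left_of_hasCompactSupport hφ.continuous hφc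
  have i3 := l3.integrable_smul_left_of_hasCompactSupport hφ.continuous hφc
  simp_rw [add_smul, smul_assoc] at key
  rw [integral_add i1 i2] at key
  simp_rw [smul_add]
  rw [integral_add i2 i3, neg_add, ← key]
  abel

end ProductRule

/-! ### Sobolev embedding and multiplication by `L^p` potentials. -/

section Sobolev

variable {n : ℕ}

/-- The Sobolev inequality `‖u‖_q ≤ C (‖u‖₂ + ‖∇u‖₂)` for compactly supported `C¹` functions. -/
def SobolevExponent (n : ℕ) (q : ENNReal) : Prop :=
  ∃ C : ENNReal, C ≠ ⊤ ∧ ∀ u : E n → ℝ, ContDiff ℝ 1 u → HasCompactSupport u →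
    eLpNorm u q volume ≤ C * (eLpNorm u 2 volume + eLpNorm (fderiv ℝ u) 2 volume)

lemma sobolevExponent_three : SobolevExponent 3 6 := by
  refine ⟨(eLpNormLESNormFDerivOfEqInnerConst (volume : Measure (E 3)) 2 : NNReal),
    ENNReal.coe_ne_top, fun u hu huc => ?_⟩
  have h := eLpNorm_le_eLpNorm_fderiv_of_eq_inner (volume : Measure (E 3)) hu huc
    (p := 2) (p' := 6) (by norm_num) (by simp) (by simp; norm_num)
  have h2 : eLpNorm (fderiv ℝ u) 2 volume
      ≤ eLpNorm u 2 volume + eLpNorm (fderiv ℝ u) 2 volume := le_add_self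
  refine le_trans ?_ (mul_le_mul_right h2 _)
  simpa using h

/-- Induction on the power. In the plane the Gagliardo–Nirenberg inequality bounds the `L²` norm by
the `L¹` norm of the gradient. Applied to `u^{m+2}`, whose gradient is `(m+2) u^{m+1} ∇u`, it yields
by Cauchy–Schwarz the bound for `u^{m+1}` times `‖∇u‖₂`. -/
lemma eLpNorm_pow_le_of_dim_two (m : ℕ) : ∃ C : ENNReal, C ≠ ⊤ ∧ ∀ u : E 2 → ℝ,
    ContDiff ℝ 1 u → HasCompactSupport u →
    eLpNorm (fun x => u x ^ (m + 1)) 2 volume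
      ≤ C * (eLpNorm u 2 volume + eLpNorm (fderiv ℝ u) 2 volume) ^ (m + 1) := by
  induction m with
  | zero =>
    refine ⟨1, by simp, fun u hu huc => ?_⟩
    simp
  | succ m ih =>
    obtain ⟨C, hC, hb⟩ := ih
    set K : ENNReal := (eLpNormLESNormFDerivOneConst (volume : Measure (E 2)) 2 : ENNReal) with hK
    refine ⟨K * (((m + 1 : ℕ) + 1 : ℕ) * C), by finiteness, fun u hu huc => ?_⟩
    set N := eLpNorm u 2 volume + eLpNorm (fderiv ℝ u) 2 volume with hN
    have h1 : ContDiff ℝ 1 fun x => u x ^ (m + 1 + 1) := hu.pow _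
    have h2 : HasCompactSupport fun x => u x ^ (m + 1 + 1) :=
      huc.comp_left (g := fun t : ℝ => t ^ (m + 1 + 1)) (by simp)
    have hconj : NNReal.HolderConjugate (Module.finrank ℝ (E 2)) 2 := by
      rw [NNReal.holderConjugate_iff]
      constructor <;> simp
      rw [← two_mul]; norm_num
    have h3 := eLpNorm_le_eLpNorm_fderiv_one (volume : Measure (E 2)) h1 h2 hconj
    have hfd : fderiv ℝ (fun x => u x ^ (m + 1 + 1))
        = (fun x => (((m + 1 : ℕ) + 1 : ℕ) : ℝ) * u x ^ (m + 1)) • fderiv ℝ u := by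
      ext1 x
      rw [fderiv_fun_pow _ ((hu.differentiable (by simp)) x)]
      simp
    have hm1 : AEStronglyMeasurable (fun x => u x ^ (m + 1)) volume :=
      (hu.continuous.pow _).aestronglyMeasurable
    have hm2 : AEStronglyMeasurable (fderiv ℝ u) volume :=
      (hu.continuous_fderiv (by simp)).aestronglyMeasurable
    have h4 : eLpNorm (fderiv ℝ (fun x => u x ^ (m + 1 + 1))) 1 volume
        ≤ ((m + 1 : ℕ) + 1 : ℕ) * (C * N ^ (m + 1) * N) := by
      have e1 : ‖(((m + 1 : ℕ) + 1 : ℕ) : ℝ)‖ₑ = (((m + 1 : ℕ) + 1 : ℕ) : ENNReal) := by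
        rw [Real.enorm_of_nonneg (by positivity), ENNReal.ofReal_natCast]
      have h5 : eLpNorm (fun x => (((m + 1 : ℕ) + 1 : ℕ) : ℝ) * u x ^ (m + 1)) 2 volume
          ≤ ((m + 1 : ℕ) + 1 : ℕ) * (C * N ^ (m + 1)) := by
        have := eLpNorm_const_smul (p := 2) (μ := volume) (((m + 1 : ℕ) + 1 : ℕ) : ℝ)
          (fun x => u x ^ (m + 1))
        rw [e1] at this
        exact this.le.trans (mul_le_mul_right (hb u hu huc) _)
      rw [hfd]
      refine (eLpNorm_smul_le_mul_eLpNorm (r := 1) hm2 (hm1.const_mul _) (p := 2) (q := 2)).trans ?_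
      rw [← mul_assoc]
      gcongr
      exact le_add_self
    calc _ ≤ K * eLpNorm (fderiv ℝ (fun x => u x ^ (m + 1 + 1))) 1 volume := by simpa using h3
      _ ≤ K * (((m + 1 : ℕ) + 1 : ℕ) * (C * N ^ (m + 1) * N)) := mul_le_mul_right h4 _
      _ = _ := by ring

lemma sobolevExponent_two (m : ℕ) : SobolevExponent 2 (2 * ENNReal.ofReal ((m + 1 : ℕ) : ℝ)) := by
  obtain ⟨C, hC, hb⟩ := eLpNorm_pow_le_of_dim_two m
  refine ⟨C ^ (((m + 1 : ℕ) : ℝ)⁻¹), by finiteness, fun u hu huc => ?_⟩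
  have hm : (0 : ℝ) < ((m + 1 : ℕ) : ℝ) := by positivity
  have h1 := eLpNorm_norm_rpow (p := 2) (μ := volume) u hm
  have h2 : eLpNorm (fun x => ‖u x‖ ^ ((m + 1 : ℕ) : ℝ)) 2 volume
      = eLpNorm (fun x => u x ^ (m + 1)) 2 volume := by
    refine eLpNorm_congr_norm_ae (Filter.Eventually.of_forall fun x => ?_)
    rw [Real.rpow_natCast, norm_pow, norm_pow, norm_norm]
  have h3 := hb u hu huc
  rw [← h2, h1] at h3
  rw [← ENNReal.rpow_le_rpow_iff hm, ENNReal.mul_rpow_of_nonneg _ _ hm.le, ← ENNReal.rpow_mul,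
    inv_mul_cancel₀ hm.ne', ENNReal.rpow_one]
  simpa only [ENNReal.rpow_natCast] using h3

lemma norm_clm_le_sum (L : E n →L[ℝ] ℝ) :
    ‖L‖ ≤ ∑ i, ‖L (EuclideanSpace.single i 1)‖ := by
  refine L.opNorm_le_bound (Finset.sum_nonneg fun i _ => norm_nonneg _) fun z => ?_
  have hz : z = ∑ i, z i • EuclideanSpace.single i (1 : ℝ) := by
    ext j
    simp [Finset.sum_apply, Pi.single_apply]
  calc ‖L z‖ = ‖∑ i, z i • L (EuclideanSpace.single i 1)‖ := by
        conv_lhs => rw [hz]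
        simp only [map_sum, map_smul]
    _ ≤ ∑ i, ‖z i • L (EuclideanSpace.single i 1)‖ := norm_sum_le _ _
    _ ≤ ∑ i, ‖z‖ * ‖L (EuclideanSpace.single i 1)‖ := by
        gcongr with i
        rw [norm_smul]
        gcongr
        exact PiLp.norm_apply_le z i
    _ = _ := by rw [← Finset.mul_sum, mul_comm]

lemma eLpNorm_fderiv_le_sum {u : E n → ℝ} (hu : ContDiff ℝ ∞ u) :
    eLpNorm (fderiv ℝ u) 2 volume
      ≤ ∑ i, eLpNorm (fun x => fderiv ℝ u x (EuclideanSpace.single i 1)) 2 volume := by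
  have h1 : eLpNorm (fderiv ℝ u) 2 volume
      ≤ eLpNorm (∑ i, fun x => ‖fderiv ℝ u x (EuclideanSpace.single i 1)‖) 2 volume := by
    refine eLpNorm_mono_real fun x => ?_
    simpa using norm_clm_le_sum (fderiv ℝ u x)
  refine h1.trans ((eLpNorm_sum_le (fun i _ => ?_) (by norm_num)).trans (le_of_eq ?_))
  · exact (continuous_fderiv_apply hu _).norm.aestronglyMeasurable
  · simp only [eLpNorm_norm]

/-- Smooth cutoffs tending to `1` with uniformly bounded gradients. -/
lemma exists_cutoff (n : ℕ) : ∃ (χ : ℕ → E n → ℝ) (M : ℝ), 0 ≤ M ∧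
    (∀ k, ContDiff ℝ ∞ (χ k)) ∧ (∀ k, HasCompactSupport (χ k)) ∧ (∀ k x, ‖χ k x‖ ≤ 1) ∧
    (∀ k x (i : Fin n), ‖fderiv ℝ (χ k) x (EuclideanSpace.single i 1)‖ ≤ M) ∧
    ∀ x, Filter.Tendsto (fun k => χ k x) Filter.atTop (nhds 1) := by
  let b : ContDiffBump (0 : E n) := ⟨1, 2, one_pos, one_lt_two⟩
  have hb : ContDiff ℝ ∞ b := b.contDiff
  obtain ⟨M, hM⟩ := (hb.continuous_fderiv (by simp)).bounded_above_of_compact_support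
    (b.hasCompactSupport.fderiv ℝ)
  have hM0 : 0 ≤ M := (norm_nonneg _).trans (hM 0)
  have hc : ∀ k : ℕ, ((k : ℝ) + 1)⁻¹ ≠ 0 := fun k => by positivity
  refine ⟨fun k x => b (((k : ℝ) + 1)⁻¹ • x), M, hM0, fun k => ?_, fun k => ?_, fun k x => ?_,
    fun k x i => ?_, fun x => ?_⟩
  · exact hb.comp (contDiff_const_smul _)
  · exact b.hasCompactSupport.comp_smul (hc k)
  · rw [Real.norm_of_nonneg b.nonneg]; exact b.le_one
  · have h1 : HasFDerivAt (fun x : E n => ((k : ℝ) + 1)⁻¹ • x)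
        (((k : ℝ) + 1)⁻¹ • ContinuousLinearMap.id ℝ (E n)) x :=
      (hasFDerivAt_id x).fun_const_smul _
    have h2 := ((hb.differentiable (by simp)) (((k : ℝ) + 1)⁻¹ • x)).hasFDerivAt.comp x h1
    have h3 : fderiv ℝ (fun x => b (((k : ℝ) + 1)⁻¹ • x)) x = _ := h2.fderiv
    rw [h3]
    simp only [ContinuousLinearMap.comp_apply, _root_.smul_apply, ContinuousLinearMap.id_apply,
      map_smul, norm_smul]
    have h4 : ‖((k : ℝ) + 1)⁻¹‖ ≤ 1 := by
      rw [Real.norm_of_nonneg (by positivity)]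
      exact inv_le_one_of_one_le₀ (by have : (0 : ℝ) ≤ k := by positivity
                                      linarith)
    calc _ ≤ 1 * (M * 1) := by
          gcongr
          refine (ContinuousLinearMap.le_opNorm _ _).trans ?_
          gcongr
          · exact hM _
          · simp
      _ = M := by ring
  · refine tendsto_const_nhds.congr' ?_
    obtain ⟨N, hN⟩ := exists_nat_ge ‖x‖
    filter_upwards [Filter.eventually_ge_atTop N] with k hk
    refine (b.one_of_mem_closedBall ?_).symm
    have h5 : (N : ℝ) ≤ k := by exact_mod_cast hk
    rw [mem_closedBall_zero_iff, norm_smul, Real.norm_of_nonneg (by positivity),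
      inv_mul_le_iff₀ (by positivity)]
    change ‖x‖ ≤ ((k : ℝ) + 1) * 1
    linarith

/-- Sobolev embedding for functions with square integrable weak gradient. -/
lemma SobolevExponent.memLp {q : ENNReal} (hq : SobolevExponent n q) {h : E n → ℝ}
    {g : Fin n → E n → ℝ} (hh : MemLp h 2 volume) (hg : ∀ i, MemLp (g i) 2 volume)
    (hd : ∀ i, HasWeakPartial i h (g i)) : MemLp h q volume := by
  obtain ⟨C, hC, hb⟩ := hq
  obtain ⟨χ, M, hM0, hχs, hχc, hχ1, hχd, hχlim⟩ := exists_cutoff n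
  have hl := hh.locallyIntegrable (by norm_num : (1 : ENNReal) ≤ 2)
  -- Truncated mollifications are smooth and compactly supported, are bounded in `H¹` uniformly in
  -- `k`, and converge to `h` almost everywhere. Fatou's lemma carries the uniform `L^q` bound to
  -- `h`.
  set ψ : ℕ → E n → ℝ := fun k x => χ k x * mollify k h x with hψ
  have hψs : ∀ k, ContDiff ℝ ∞ (ψ k) := fun k => (hχs k).mul (contDiff_mollify k hl)
  have hψc : ∀ k, HasCompactSupport (ψ k) := fun k => (hχc k).mul_right
  have hψ2 : ∀ k, eLpNorm (ψ k) 2 volume ≤ eLpNorm h 2 volume := by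
    intro k
    refine le_trans (eLpNorm_mono fun x => ?_) (eLpNorm_mollify_le k hh.1)
    rw [norm_mul]
    exact mul_le_of_le_one_left (norm_nonneg _) (hχ1 k x)
  have hψd : ∀ k i, eLpNorm (fun x => fderiv ℝ (ψ k) x (EuclideanSpace.single i 1)) 2 volume
      ≤ ENNReal.ofReal M * eLpNorm h 2 volume + eLpNorm (g i) 2 volume := by
    intro k i
    set e : E n := EuclideanSpace.single i 1 with he
    have hfd : (fun x => fderiv ℝ (ψ k) x e)
        = (fun x => fderiv ℝ (χ k) x e * mollify k h x) + fun x => χ k x * mollify k (g i) x := by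
      ext x
      rw [hψ, fderiv_fun_mul (((hχs k).differentiable (by simp)) x)
        (((contDiff_mollify k hl).differentiable (by simp)) x)]
      simp only [Pi.add_apply, _root_.add_apply, _root_.smul_apply, smul_eq_mul]
      rw [he, fderiv_mollify k (hd i)]
      ring
    have c1 := continuous_fderiv_apply (hχs k) e
    have c2 := (contDiff_mollify k hl).continuous
    have c3 := (contDiff_mollify k (hd i).2.1).continuous
    rw [hfd]
    refine (eLpNorm_add_le (c1.fun_mul c2).aestronglyMeasurable
      ((hχs k).continuous.fun_mul c3).aestronglyMeasurable (by norm_num)).trans (add_le_add ?_ ?_)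
    · refine (eLpNorm_le_mul_eLpNorm_of_ae_le_mul (c := M) (g := mollify k h)
        (Filter.Eventually.of_forall fun x => ?_) 2).trans
        (mul_le_mul_right (eLpNorm_mollify_le k hh.1) _)
      rw [norm_mul]
      gcongr
      exact hχd k x i
    · refine le_trans (eLpNorm_mono fun x => ?_) (eLpNorm_mollify_le k (hg i).1)
      rw [norm_mul]
      exact mul_le_of_le_one_left (norm_nonneg _) (hχ1 k x)
  set B : ENNReal := C * (eLpNorm h 2 volume
    + ∑ i, (ENNReal.ofReal M * eLpNorm h 2 volume + eLpNorm (g i) 2 volume)) with hB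
  have hBfin : B < ⊤ := by
    refine ENNReal.mul_lt_top hC.lt_top (ENNReal.add_lt_top.2 ⟨hh.2, ENNReal.sum_lt_top.2 fun i _ => ?_⟩)
    exact ENNReal.add_lt_top.2 ⟨ENNReal.mul_lt_top (by simp) hh.2, (hg i).2⟩
  have hψB : ∀ k, eLpNorm (ψ k) q volume ≤ B := by
    intro k
    refine (hb _ ((hψs k).of_le (by simp)) (hψc k)).trans ?_
    rw [hB]
    gcongr
    · exact hψ2 k
    · exact (eLpNorm_fderiv_le_sum (hψs k)).trans (Finset.sum_le_sum fun i _ => hψd k i)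
  refine ⟨hh.1, lt_of_le_of_lt ?_ hBfin⟩
  refine (Lp.eLpNorm_lim_le_liminf_eLpNorm (f := ψ)
    (fun k => (hψs k).continuous.aestronglyMeasurable) h ?_).trans ?_
  · filter_upwards [ae_tendsto_mollify hl] with x hx
    simpa using (hχlim x).mul hx
  · exact Filter.liminf_le_of_le (by isBoundedDefault) fun b hb => by
      obtain ⟨k, hk⟩ := hb.exists
      exact hk.trans (hψB k)

/-- Pointwise `|h|^q ≤ |h|² + |h|^Q`, according to whether `|h|` is below or above 1. -/
lemma memLp_interpolate {X : Type*} [MeasurableSpace X] {μ : Measure X} {h : X → ℝ} {q Q : ℝ}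
    (h2 : MemLp h 2 μ) (hQ : MemLp h (ENNReal.ofReal Q) μ) (hq : 2 ≤ q) (hqQ : q ≤ Q) :
    MemLp h (ENNReal.ofReal q) μ := by
  have key : ∀ {r : ℝ}, 2 ≤ r → (MemLp h (ENNReal.ofReal r) μ ↔ Integrable (fun x => ‖h x‖ ^ r) μ) := by
    intro r hr
    have := integrable_norm_rpow_iff h2.1 (p := ENNReal.ofReal r) (by simp; linarith) (by simp)
    rw [ENNReal.toReal_ofReal (by linarith)] at this
    exact this.symm
  have h2' : MemLp h (ENNReal.ofReal 2) μ := by simpa using h2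
  rw [key hq]
  refine Integrable.mono' (((key le_rfl).1 h2').add ((key (hq.trans hqQ)).1 hQ)) ?_ ?_
  · exact (h2.1.norm.aemeasurable.pow_const q).aestronglyMeasurable
  · filter_upwards with x
    rw [Real.norm_of_nonneg (by positivity)]
    simp only [Pi.add_apply]
    have p1 : 0 ≤ ‖h x‖ ^ (2 : ℝ) := by positivity
    have p2 : 0 ≤ ‖h x‖ ^ Q := by positivity
    rcases (norm_nonneg (h x)).eq_or_lt with h0 | h0
    · rw [← h0, Real.zero_rpow (by linarith)]
      positivity
    rcases le_or_gt ‖h x‖ 1 with h1 | h1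
    · have := Real.rpow_le_rpow_of_exponent_ge h0 h1 hq
      linarith
    · have := Real.rpow_le_rpow_of_exponent_le h1.le hqQ
      linarith

lemma ExponentOK.two_lt {p : ENNReal} (hp : ExponentOK n p) : 2 < p := by
  rcases hp with ⟨_, h⟩ | ⟨_, h⟩
  · exact lt_of_lt_of_le (by norm_num) h
  · exact h

/-- An admissible exponent `p` pairs with a Sobolev exponent: `1/p + 1/Q ≤ 1/2`. -/
lemma ExponentOK.exists_sobolevExponent {p : ENNReal} (hp : ExponentOK n p) :
    ∃ Q : ℝ, (1 / 2 - (p⁻¹).toReal)⁻¹ ≤ Q ∧ SobolevExponent n (ENNReal.ofReal Q) := by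
  rcases hp with ⟨rfl, h⟩ | ⟨rfl, h⟩
  · refine ⟨6, ?_, by simpa using sobolevExponent_three⟩
    have h1 : (p⁻¹).toReal ≤ 1 / 3 := by
      have := ENNReal.toReal_mono (by simp) (ENNReal.inv_le_inv.2 h)
      simpa using this
    calc _ ≤ ((1 : ℝ) / 6)⁻¹ := by
          gcongr; linarith
      _ = 6 := by norm_num
  -- In the plane `p > 2` makes the Hölder partner finite, and the Sobolev exponents `2(m+1)` are
  -- unbounded.
  · obtain ⟨m, hm⟩ := exists_nat_ge (1 / 2 - (p⁻¹).toReal)⁻¹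
    refine ⟨2 * ((m + 1 : ℕ) : ℝ), ?_, ?_⟩
    · push_cast
      have : (0 : ℝ) ≤ m := by positivity
      linarith
    · have := sobolevExponent_two m
      rw [ENNReal.ofReal_mul (by norm_num)]
      simpa using this

lemma two_le_conj_exponent {p : ENNReal} (hp : 2 < p) : 2 ≤ (1 / 2 - (p⁻¹).toReal)⁻¹ := by
  have h := (holderTriple_two hp).1
  calc (2 : ℝ) = (1 / 2)⁻¹ := by norm_num
    _ ≤ _ := by
      gcongr
      have : 0 ≤ (p⁻¹).toReal := ENNReal.toReal_nonneg
      linarith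

lemma MemWLp.contDiff_bracket_smul_partial {σ : ℝ} {f g : E n → ℂ} (hf : MemWLp 2 (-σ) f)
    (hg : MemWLp 2 (-σ) g) (v : E n) :
    MemLp (fun x => fderiv ℝ (bracket (-σ)) x v • f x + bracket (-σ) x • g x) 2 volume := by
  refine MemLp.add ?_ (memWLp_iff.1 hg)
  refine MemLp.of_le_mul (c := |-σ| * ‖v‖) (memWLp_iff.1 hf)
    ((continuous_fderiv_apply (contDiff_bracket _) v).aestronglyMeasurable.smul
      hf.aestronglyMeasurable) ?_
  filter_upwards with x
  rw [norm_smul, norm_smul, Real.norm_eq_abs, Real.norm_of_nonneg (bracket_pos _ _).le]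
  calc _ ≤ |-σ| * bracket (-σ) x * ‖v‖ * ‖f x‖ := by gcongr; exact abs_fderiv_bracket_le _ _ _
    _ = _ := by ring

/-- Multiplication by an `L^p` potential maps `H¹_{-σ}` to `L²_{-σ}`. -/
lemma MemH1.smul {p : ENNReal} (hp : ExponentOK n p) {σ s : ℝ} (hs : 0 ≤ s) {A : E n → ℝ}
    (hA : MemWLp p s A) {f : E n → ℂ} (hf : MemH1 (-σ) f) :
    MemWLp 2 (-σ) (fun x => A x • f x) := by
  obtain ⟨hf0, hf1⟩ := hf
  choose g hg hg2 using hf1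
  have hA0 : MemLp A p volume := by
    have := memWLp_iff.1 (hA.mono hs)
    simpa [bracket_zero] using this
  set h : E n → ℂ := fun x => bracket (-σ) x • f x with hh
  have hh2 : MemLp h 2 volume := memWLp_iff.1 hf0
  obtain ⟨Q, hQ, hSob⟩ := hp.exists_sobolevExponent
  obtain ⟨hc, hH⟩ := holderTriple_two hp.two_lt
  have hdh : ∀ i, HasWeakPartial i h _ := fun i => (hg i).contDiff_smul (contDiff_bracket (-σ))
  have hdh2 := fun i => hf0.contDiff_bracket_smul_partial (hg2 i) (EuclideanSpace.single i 1)
  -- The Sobolev inequality is available for real functions; `L` will be the real and the imaginary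
  -- part.
  have hpart : ∀ L : ℂ →L[ℝ] ℝ, MemLp (fun x => L (h x))
      (ENNReal.ofReal (1 / 2 - (p⁻¹).toReal)⁻¹) volume := by
    intro L
    have m2 : MemLp (fun x => L (h x)) 2 volume := L.comp_memLp' hh2
    have mQ := hSob.memLp m2 (fun i => L.comp_memLp' (hdh2 i)) (fun i => (hdh i).clm_comp L)
    exact memLp_interpolate m2 mQ (two_le_conj_exponent hp.two_lt) hQ
  have hq : MemLp h (ENNReal.ofReal (1 / 2 - (p⁻¹).toReal)⁻¹) volume := by
    have h1 := (hpart Complex.reCLM).norm.add (hpart Complex.imCLM).norm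
    refine h1.mono hh2.1 (Filter.Eventually.of_forall fun x => ?_)
    simp only [Pi.add_apply, Complex.reCLM_apply, Complex.imCLM_apply]
    rw [Real.norm_of_nonneg (by positivity)]
    exact Complex.norm_le_abs_re_add_abs_im (h x)
  have := MemLp.smul (r := 2) hq hA0
  refine memWLp_iff.2 (this.ae_eq (Filter.Eventually.of_forall fun x => ?_))
  simp only [hh, Pi.smul_apply']
  rw [smul_comm]

end Sobolev

/-! ### The source term, plane waves and the resolvent bound. -/

section Resolvent

variable {n : ℕ}

/-- The class `L¹_{-(n-1)/2} ∩ L²_{-σ}` of sources on which the outgoing resolvent acts by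
absolutely convergent integrals. -/
def IsSource (σ : ℝ) (g : E n → ℂ) : Prop :=
  MemWLp 1 (-(((n : ℝ) - 1) / 2)) g ∧ MemWLp 2 (-σ) g

namespace IsSource

variable {σ : ℝ} {g h : E n → ℂ}

lemma add (hg : IsSource σ g) (hh : IsSource σ h) : IsSource σ (fun x => g x + h x) :=
  ⟨hg.1.add hh.1, hg.2.add hh.2⟩

lemma const_mul (hg : IsSource σ g) (c : ℂ) : IsSource σ (fun x => c * g x) :=
  ⟨hg.1.of_le (C := ‖c‖) le_rfl (hg.1.aestronglyMeasurable.const_mul c) (by simp),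
    hg.2.of_le (C := ‖c‖) le_rfl (hg.2.aestronglyMeasurable.const_mul c) (by simp)⟩

lemma zero : IsSource σ (fun _ : E n => (0 : ℂ)) := by
  constructor <;> simp [memWLp_iff]

lemma sum {ι : Type*} (s : Finset ι) {g : ι → E n → ℂ} (hg : ∀ i ∈ s, IsSource σ (g i)) :
    IsSource σ (fun x => ∑ i ∈ s, g i x) := by
  classical
  induction s using Finset.induction_on with
  | empty => simpa using zero
  | insert i s hi ih =>
    simp_rw [Finset.sum_insert hi]
    exact (hg i (Finset.mem_insert_self i s)).add
      (ih fun j hj => hg j (Finset.mem_insert_of_mem hj))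

lemma congr (hg : IsSource σ g) (h' : g =ᵐ[volume] h) : IsSource σ h :=
  ⟨hg.1.congr h', hg.2.congr h'⟩

lemma smul_of_memH1 {p : ENNReal} (hp : ExponentOK n p) {s : ℝ} (hs : 0 ≤ s) {A : E n → ℝ}
    (hA : MemWLp p s A) (hσ : σ < s - 1 / 2 + n * (p⁻¹).toReal) (hg : MemH1 (-σ) g) :
    IsSource σ (fun x => A x • g x) :=
  ⟨hA.smul_one hp.two_lt hg.1 hσ, hg.smul hp hs hA⟩

/-- Needed for `W·∇f`: the gradient is only in `L²_{-σ}`, so Sobolev embedding is not available and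
boundedness of the coefficient takes its place. -/
lemma smul_of_top {s : ℝ} (hs : 0 ≤ s) {A : E n → ℝ} (hA : MemWLp ⊤ s A) (hσ : σ < s - 1 / 2)
    (hg : MemWLp 2 (-σ) g) : IsSource σ (fun x => A x • g x) :=
  ⟨hA.smul_one (by simp) hg (by simpa using hσ), (hA.smul (r := 2) hg).mono (by linarith)⟩

end IsSource

lemma memWLp_two_of_bounded {σ C : ℝ} (hσ : (n : ℝ) / 2 < σ) {g : E n → ℂ}
    (hg : AEStronglyMeasurable g volume) (h : ∀ x, ‖g x‖ ≤ C) : MemWLp 2 (-σ) g := by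
  have h1 := memLp_bracket (n := n) (τ := σ) (q := 2) (by norm_num) (by linarith)
  have h2 : MemWLp 2 (-σ) (fun _ : E n => (1 : ℝ)) := by
    rw [memWLp_iff]; simpa using h1
  exact h2.of_le (C := C) le_rfl hg (Filter.Eventually.of_forall fun x => by simpa using h x)

/-- Plane waves belong to `H¹_{-σ}` for `σ > n/2`. -/
lemma memH1_planeWave {σ : ℝ} (hσ : (n : ℝ) / 2 < σ) (k : ℝ) (θ : E n) :
    MemH1 (-σ) (planeWave k θ) := by
  set L : E n →L[ℝ] ℂ := (k • innerSL ℝ θ).smulRight Complex.I with hL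
  have hLapp : ∀ x, L x = Complex.I * ((k * inner ℝ x θ : ℝ) : ℂ) := by
    intro x
    simp only [hL, ContinuousLinearMap.smulRight_apply, _root_.smul_apply, innerSL_apply_apply,
      smul_eq_mul, Complex.real_smul]
    rw [real_inner_comm, mul_comm]
  have he : planeWave k θ = fun x => Complex.exp (L x) := by
    ext x; rw [planeWave, hLapp]
  have hn1 : ∀ x, ‖Complex.exp (L x)‖ = 1 := by
    intro x
    rw [hLapp, mul_comm, Complex.norm_exp_ofReal_mul_I]
  have hs : ContDiff ℝ ∞ (planeWave k θ) := by
    rw [he]; exact L.contDiff.cexp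
  have hfd : ∀ x, fderiv ℝ (planeWave k θ) x = Complex.exp (L x) • L := by
    intro x
    rw [he]
    exact L.hasFDerivAt.cexp.fderiv
  refine ⟨memWLp_two_of_bounded (C := 1) hσ hs.continuous.aestronglyMeasurable fun x => ?_,
    fun i => ⟨_, hasWeakPartial_of_contDiff i hs, memWLp_two_of_bounded (C := ‖L‖) hσ
      (continuous_fderiv_apply hs _).aestronglyMeasurable fun x => ?_⟩⟩
  · rw [he, hn1]
  · rw [hfd, _root_.smul_apply, norm_smul, hn1, one_mul]
    refine (L.le_opNorm _).trans ?_
    simp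

lemma ExponentOK.dim {p : ENNReal} (hp : ExponentOK n p) : n = 2 ∨ n = 3 := by
  rcases hp with ⟨h, _⟩ | ⟨h, _⟩
  · exact Or.inr h
  · exact Or.inl h

/-- Since `p > 2`, the term `n/p` stays below `n/2`. The weights are therefore positive, and the
coefficients also lie in the unweighted `L^p` spaces. -/
lemma ExponentOK.weightBound_nonneg {p : ENNReal} (hp : ExponentOK n p) : 0 ≤ weightBound n p := by
  have h := (holderTriple_two hp.two_lt).1
  have : (n : ℝ) * (p⁻¹).toReal ≤ n * (1 / 2) := by gcongr; linarith
  rw [weightBound]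
  linarith

lemma memWLp_apply {p : ENNReal} {σ : ℝ} {W : E n → E n} (hW : MemWLp p σ W) (i : Fin n) :
    MemWLp p σ (fun x => W x i) :=
  hW.of_le (C := 1) le_rfl
    ((EuclideanSpace.proj (𝕜 := ℝ) i).continuous.comp_aestronglyMeasurable hW.aestronglyMeasurable)
    (Filter.Eventually.of_forall fun x => by simpa using PiLp.norm_apply_le (W x) i)

section

variable {p₁ p₂ : ENNReal} {δ δ₁ δ₂ σ : ℝ} {W : E n → E n} {V : E n → ℝ}

lemma hasWeakPartial_component_mul {f g : E n → ℂ} {dW : E n → E n} {i : Fin n} (hp₁ : 2 ≤ p₁)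
    (hW : MemWLp ⊤ δ W) (hdW : HasWeakPartial i W dW) (hdW' : MemWLp p₁ δ₁ dW)
    (hf : MemWLp 2 σ f) (hg : MemWLp 2 σ g) (hfg : HasWeakPartial i f g) :
    HasWeakPartial i (fun x => (W x i : ℂ) * f x) (fun x => dW x i • f x + W x i • g x) := by
  have h := (hdW.clm_comp (EuclideanSpace.proj (𝕜 := ℝ) i)).smul hfg
    (fun R => (memWLp_apply hW i).memLp_two_restrict (by simp) R)
    (fun R => (memWLp_apply hdW' i).memLp_two_restrict hp₁ R)
    (fun R => hf.memLp_two_restrict le_rfl R) (fun R => hg.memLp_two_restrict le_rfl R)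
  simp only [Complex.real_smul] at h ⊢
  exact h

/-- The source term of the magnetic Schrödinger operator applied to an `H¹_{-σ}` function. -/
lemma isSource_source (hp₁ : ExponentOK n p₁) (hp₂ : ExponentOK n p₂)
    (hδ : 0 ≤ δ) (hδ₁ : 0 ≤ δ₁) (hδ₂ : 0 ≤ δ₂)
    (hσ : σ < δ - 1 / 2) (hσ₁ : σ < δ₁ - 1 / 2 + n * (p₁⁻¹).toReal)
    (hσ₂ : σ < δ₂ - 1 / 2 + n * (p₂⁻¹).toReal)
    (hW : MemWLp ⊤ δ W) (hgradW : WeakGradMemWLp p₁ δ₁ W) (hV : MemWLp p₂ δ₂ V)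
    {f : E n → ℂ} (hf : MemH1 (-σ) f) : IsSource σ (source W V f) := by
  have hf' := hf
  obtain ⟨hf0, hf1⟩ := hf'
  choose g hg hg2 using hf1
  choose dW hdW hdW' using hgradW
  have hWi := fun i => memWLp_apply hW i
  have t1 : ∀ i, IsSource σ (fun x => dW i x i • f x) := fun i =>
    .smul_of_memH1 hp₁ hδ₁ (memWLp_apply (hdW' i) i) hσ₁ hf
  have t2 : ∀ i, IsSource σ (fun x => W x i • g i x) := fun i =>
    .smul_of_top hδ (hWi i) hσ (hg2 i)
  have hWsq : MemWLp ⊤ δ (fun x => ‖W x‖ ^ 2) := by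
    have h1 : MemWLp ⊤ δ (fun x => ‖W x‖) :=
      hW.of_le (C := 1) le_rfl hW.aestronglyMeasurable.norm (by simp)
    have h2 := (h1.smul (r := ⊤) h1).mono (show δ ≤ δ + δ by linarith)
    simpa [sq] using h2
  have t3 : IsSource σ (fun x => (‖W x‖ ^ 2) • f x) := .smul_of_top hδ hWsq hσ hf0
  have t4 : IsSource σ (fun x => V x • f x) := .smul_of_memH1 hp₂ hδ₂ hV hσ₂ hf
  have key := (((IsSource.sum Finset.univ fun i _ => (t1 i).add (t2 i)).const_mul Complex.I).add
    ((IsSource.sum Finset.univ fun i _ => t2 i).const_mul Complex.I)).add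
    ((t3.add t4).const_mul (-1))
  refine key.congr ?_
  -- The source is built from chosen weak derivatives. They agree almost everywhere with `g` and
  -- with the product-rule expression.
  have ae1 : ∀ᵐ x, ∀ i, weakPartial i f x = g i x :=
    ae_all_iff.2 fun i => (hg i).weakPartial_ae_eq
  have ae2 : ∀ᵐ x, ∀ i, weakPartial i (fun x => (W x i : ℂ) * f x) x
      = dW i x i • f x + W x i • g i x :=
    ae_all_iff.2 fun i => (hasWeakPartial_component_mul hp₁.two_lt.le hW (hdW i) (hdW' i) hf0
      (hg2 i) (hg i)).weakPartial_ae_eq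
  filter_upwards [ae1, ae2] with x h1 h2
  simp only [source, h1, h2, Complex.real_smul]
  push_cast
  ring

lemma lkDefined_and_memH1 (hp₁ : ExponentOK n p₁) (hp₂ : ExponentOK n p₂)
    (hδ : 0 ≤ δ) (hδ₁ : 0 ≤ δ₁) (hδ₂ : 0 ≤ δ₂) (hnσ : (n : ℝ) / 2 < σ)
    (hσ : σ < δ - 1 / 2) (hσ₁ : σ < δ₁ - 1 / 2 + n * (p₁⁻¹).toReal)
    (hσ₂ : σ < δ₂ - 1 / 2 + n * (p₂⁻¹).toReal)
    (hW : MemWLp ⊤ δ W) (hgradW : WeakGradMemWLp p₁ δ₁ W) (hV : MemWLp p₂ δ₂ V)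
    {k : ℝ} (hk : k ≠ 0) {f : E n → ℂ} (hf : MemH1 (-σ) f) :
    LkDefined k W V f ∧ MemH1 (-σ) (Lk k W V f) := by
  have hn : 2 ≤ n := by rcases hp₁.dim with h | h <;> omega
  have hS := isSource_source hp₁ hp₂ hδ hδ₁ hδ₂ hσ hσ₁ hσ₂ hW hgradW hV hf
  obtain ⟨G', C, hC, hG⟩ := kernelBound_greenPlus hp₁.dim (abs_pos.2 hk)
  have hK := hG.isGreenKernel hn
  refine ⟨⟨fun i => ?_, fun i => ?_, hK.ae_integrable hn hnσ hS.1 hS.2⟩,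
    hK.memWLp_integral hn hnσ hS.1 hS.2,
    fun i => ⟨_, hG.hasWeakPartial_integral hn hC hnσ hS.1 hS.2 i,
      (hG.isGreenKernel_partial hn i).memWLp_integral hn hnσ hS.1 hS.2⟩⟩
  · obtain ⟨dW, hdW, hdW'⟩ := hgradW i
    obtain ⟨g, hg, hg2⟩ := hf.2 i
    exact ⟨_, hasWeakPartial_component_mul hp₁.two_lt.le hW hdW hdW' hf.1 hg2 hg⟩
  · obtain ⟨g, hg, _⟩ := hf.2 i
    exact ⟨g, hg⟩

end

end Resolvent

end MagneticScattering

end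

open MagneticScattering in
theorem lemma2p1 (n : ℕ) (p₁ p₂ : ENNReal) (hp₁ : ExponentOK n p₁) (hp₂ : ExponentOK n p₂)
    (δ δ₁ δ₂ : ℝ) (hδ : weightBound n ⊤ < δ) (hδ₁ : weightBound n p₁ < δ₁)
    (hδ₂ : weightBound n p₂ < δ₂)
    (W : E n → E n) (V : E n → ℝ)
    (hW : MemWLp ⊤ δ W) (hgradW : WeakGradMemWLp p₁ δ₁ W) (hV : MemWLp p₂ δ₂ V) :
    ∃ δ₀ : ℝ, 1 / 2 < δ₀ ∧ ∀ k : ℝ, k ≠ 0 →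
      (∀ θ : E n, ‖θ‖ = 1 →
        LkDefined k W V (planeWave k θ) ∧ MemH1 (-δ₀) (Lk k W V (planeWave k θ))) ∧
      (∀ f : E n → ℂ, MemH1 (-δ₀) f → LkDefined k W V f ∧ MemH1 (-δ₀) (Lk k W V f)) := by
  have hn : (2 : ℝ) ≤ n := by rcases hp₁.dim with h | h <;> rw [h] <;> norm_num
  have h0₁ := hp₁.weightBound_nonneg
  have h0₂ := hp₂.weightBound_nonneg
  -- This and the next two facts rewrite the three weight conditions as upper limits for `σ`, each
  -- above `n/2`.
  have hδ' : (n : ℝ) / 2 < δ - 1 / 2 := by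
    simp only [weightBound, ENNReal.inv_top, ENNReal.toReal_zero] at hδ
    linarith
  have hδ₁' : (n : ℝ) / 2 < δ₁ - 1 / 2 + n * (p₁⁻¹).toReal := by
    simp only [weightBound] at hδ₁
    linarith
  have hδ₂' : (n : ℝ) / 2 < δ₂ - 1 / 2 + n * (p₂⁻¹).toReal := by
    simp only [weightBound] at hδ₂
    linarith
  -- Any `σ` strictly between `n/2` and the three limits serves as `δ₀`; it exceeds `1/2` because `n
  -- ≥ 2`, and it does not involve `k`.
  obtain ⟨σ, hnσ, hσ⟩ := exists_between (lt_min hδ' (lt_min hδ₁' hδ₂'))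
  obtain ⟨h1, h2⟩ := lt_min_iff.1 hσ
  obtain ⟨h2, h3⟩ := lt_min_iff.1 h2
  have main : ∀ k : ℝ, k ≠ 0 → ∀ f : E n → ℂ, MemH1 (-σ) f →
      LkDefined k W V f ∧ MemH1 (-σ) (Lk k W V f) := fun k hk f hf =>
    lkDefined_and_memH1 hp₁ hp₂ (by linarith) (by linarith) (by linarith) hnσ h1 h2 h3
      hW hgradW hV hk hf
  exact ⟨σ, by linarith, fun k hk =>
    ⟨fun θ _ => main k hk _ (memH1_planeWave hnσ k θ), main k hk⟩⟩
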